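/- For $\tau\in\mathbb H$ let $E_\tau=\mathbb C/(\mathbb Z\oplus\mathbb Z\tau)$ with coordinate $z$, and let $\check E$ be the two-torus $\mathbb R^2/\mathbb Z^2$ with some complex structure and a symplectic form $\omega$ of area one. *A-model.* This is the trivial bundle with fibre $H^\bullet(\check E,\mathbb C)$ over the moduli space of complexified Kähler classes $\rho=b+iA\in\mathbb H/\mathbb Z$, with coordinate $q=e^{2\pi i\rho}$. It carries the filtration $H^0\subset H^0\oplus H^2$ of its even part, the Poincaré pairing $\langle x,y\rangle_{P}=\int_{\check E}x\cup y$ and the Dubrovin connection $\nabla^{D}_{q\partial_q}x=q\partial_q x-x\cup[\omega]$. *B-model.* Put $HH_n(E_\tau)=\bigoplus_{q-p=n}H^p(E_\tau,\Omega^q)$ (Hochschild–Kostant–Rosenberg), with the Mukai pairing $\langle u,v\rangle_{M}=\frac1{2\pi i}\int_{E_\tau}(-1)^{|u|}u\wedge v$, where $|u|=q$ for $u\in H^p(E_\tau,\Omega^q)$. The bundle over $\mathbb H/\mathbb Z$ with fibre $H^\bullet_{dR}(E_\tau)$ carries the Gauss–Manin connection $\nabla^{GM}$ and the Hodge filtration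 $HH_1(E_\tau)=H^0(E_\tau,\Omega^1)\subset H^1_{dR}(E_\tau)$, with projection $H^1_{dR}(E_\tau)\to HH_{-1}(E_\tau)=H^1(E_\tau,\mathcal O)$; moreover $HH_0(E_\tau)$ is identified with $H^0_{dR}(E_\tau)\oplus H^2_{dR}(E_\tau)$. A *mirror isomorphism* over a neighbourhood $\{\operatorname{Im}\tau>R\}$ of the cusp, along the mirror map $\rho=\tau$, is a family of linear isomorphisms $\Phi_\tau:H^\bullet(\check E,\mathbb C)\to H^\bullet_{dR}(E_\tau)$, invariant under $\tau\mapsto\tau+1$, that exchanges even and odd degrees, identifies the filtrations, takes $\nabla^{D}_{q\partial_q}$ to $\nabla^{GM}_{\frac1{2\pi i}\partial_\tau}$, and whose induced correspondence between $H^{1-\bullet}(\check E)$ and $HH_\bullet(E_\tau)$ takes the Poincaré pairing to the Mukai pairing. **Proposition.** For every $R\in\mathbb R$ (the region being all of $\mathbb H$ if $R\le 0$) there is a mirror isomorphism under which, for all $\tau\in\mathbb H$ with $\operatorname{Im}\tau>R$, the class $1\in H^0(\check E)$ corresponds to $$[\Omega]=[2\pi i\,dz]\in HH_1(E_\tau),$$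 and the class $[\mathrm{pt}]^{PD}\in H^2(\check E)$, Poincaré dual to a point, corresponds to $$[\xi]=\frac{1}{\tau-\bar\tau}[d\bar z]\in HH_{-1}(E_\tau).$$ Moreover, for every mirror isomorphism there is a sign $\varepsilon\in\{1,-1\}$, independent of $\tau$, such that $1$ corresponds to exactly $\varepsilon[\Omega]$ and $[\mathrm{pt}]^{PD}$ to exactly $\varepsilon[\xi]$ for all such $\tau$. -/

import Mathlib

namespace EllipticMirror

open Complex
open scoped UpperHalfPlane ComplexConjugate

noncomputable section

/-! ### Smooth forms on the complex torus `E_τ = ℂ / (ℤ + ℤ τ)`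

Smooth functions on `E_τ` are smooth functions on `ℂ` that are periodic under `1` and `τ`.
A `1`-form `f dz + g dz̄` is the pair `(f, g)`, and a `2`-form `h dz ∧ dz̄` is the function `h`. -/

/-- The algebra of smooth complex valued functions on `E_τ`. -/
def smoothAlgebra (τ : ℍ) : Subalgebra ℂ (ℂ → ℂ) where
  carrier := {f | ContDiff ℝ (⊤ : ℕ∞) f ∧ (∀ z, f (z + 1) = f z) ∧ ∀ z, f (z + (τ : ℂ)) = f z}
  mul_mem' {f g} hf hg := ⟨hf.1.mul hg.1,
    fun z => by simp [hf.2.1 z, hg.2.1 z], fun z => by simp [hf.2.2 z, hg.2.2 z]⟩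
  add_mem' {f g} hf hg := ⟨hf.1.add hg.1,
    fun z => by simp [hf.2.1 z, hg.2.1 z], fun z => by simp [hf.2.2 z, hg.2.2 z]⟩
  algebraMap_mem' c := ⟨contDiff_const, fun _ => rfl, fun _ => rfl⟩

/-- The type of smooth complex valued functions on `E_τ`. -/
def Fn (τ : ℍ) : Type := smoothAlgebra τ

instance (τ : ℍ) : CommRing (Fn τ) := inferInstanceAs (CommRing (smoothAlgebra τ))

instance (τ : ℍ) : Algebra ℂ (Fn τ) := inferInstanceAs (Algebra ℂ (smoothAlgebra τ))

instance (τ : ℍ) : CoeFun (Fn τ) (fun _ => ℂ → ℂ) := ⟨fun f => f.1⟩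

variable (τ : ℍ)

@[ext] theorem Fn.ext {τ : ℍ} {f g : Fn τ} (h : ∀ z, f z = g z) : f = g :=
  Subtype.ext (funext h)

theorem Fn.smooth (f : Fn τ) : ContDiff ℝ (⊤ : ℕ∞) (fun z => f z) := f.2.1

theorem Fn.add_one (f : Fn τ) (z : ℂ) : f (z + 1) = f z := f.2.2.1 z

theorem Fn.add_tau (f : Fn τ) (z : ℂ) : f (z + τ) = f z := f.2.2.2 z

theorem Fn.differentiable (f : Fn τ) : Differentiable ℝ (fun z => f z) :=
  f.2.1.differentiable (by simp)

/-- The derivative of a smooth function on `E_τ` in the direction of the constant real vector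
field `v`. -/
def dirDeriv (v : ℂ) : Fn τ →ₗ[ℂ] Fn τ where
  toFun f := ⟨fun z => fderiv ℝ (fun w => f w) z v, by
    refine ⟨(f.2.1.fderiv_right (m := (⊤ : ℕ∞)) (by simp)).clm_apply contDiff_const, fun z => ?_,
      fun z => ?_⟩
    · change fderiv ℝ (fun w => f w) (z + 1) v = fderiv ℝ (fun w => f w) z v
      rw [← fderiv_comp_add_right]
      exact congrArg (fun k => fderiv ℝ k z v) (funext f.add_one)
    · change fderiv ℝ (fun w => f w) (z + (τ : ℂ)) v = fderiv ℝ (fun w => f w) z v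
      rw [← fderiv_comp_add_right]
      exact congrArg (fun k => fderiv ℝ k z v) (funext f.add_tau)⟩
  map_add' f g := by
    ext z
    change fderiv ℝ ((fun w => f w) + (fun w => g w)) z v = _
    rw [fderiv_add (f.differentiable τ z) (g.differentiable τ z)]
    rfl
  map_smul' c f := by
    ext z
    change fderiv ℝ (c • (fun w => f w)) z v = _
    rw [fderiv_const_smul (f.differentiable τ z)]
    rfl

/-- The Wirtinger derivative `∂/∂z`. -/
def del : Fn τ →ₗ[ℂ] Fn τ := (1 / 2 : ℂ) • (dirDeriv τ 1 - I • dirDeriv τ I)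

/-- The Wirtinger derivative `∂/∂z̄`. -/
def delbar : Fn τ →ₗ[ℂ] Fn τ := (1 / 2 : ℂ) • (dirDeriv τ 1 + I • dirDeriv τ I)

theorem dirDeriv_mul (v : ℂ) (f g : Fn τ) :
    dirDeriv τ v (f * g) = f * dirDeriv τ v g + dirDeriv τ v f * g := by
  ext z
  change fderiv ℝ ((fun w => f w) * (fun w => g w)) z v
    = f z * fderiv ℝ (fun w => g w) z v + fderiv ℝ (fun w => f w) z v * g z
  rw [fderiv_mul (f.differentiable τ z) (g.differentiable τ z)]
  simp [mul_comm]

theorem del_mul (f g : Fn τ) : del τ (f * g) = f * del τ g + del τ f * g := by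
  simp only [del, LinearMap.smul_apply, LinearMap.sub_apply, dirDeriv_mul, mul_smul_comm,
    smul_mul_assoc, smul_add, smul_sub, mul_sub, sub_mul]
  abel

theorem delbar_mul (f g : Fn τ) : delbar τ (f * g) = f * delbar τ g + delbar τ f * g := by
  simp only [delbar, LinearMap.smul_apply, LinearMap.add_apply, dirDeriv_mul, mul_smul_comm,
    smul_mul_assoc, smul_add, mul_add, add_mul]
  abel

theorem dirDeriv_eq (v : ℂ) (f : Fn τ) :
    dirDeriv τ v f = v • del τ f + conj v • delbar τ f := by
  ext z
  have h (L : ℂ →L[ℝ] ℂ) : L v = v.re * L 1 + v.im * L I := by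
    have hv : v = v.re • (1 : ℂ) + v.im • I := by simp [re_add_im]
    conv_lhs => rw [hv]
    rw [map_add, map_smul, map_smul, real_smul, real_smul]
  change fderiv ℝ (fun w => f w) z v
    = v * ((1 / 2 : ℂ) * (fderiv ℝ (fun w => f w) z 1 - I * fderiv ℝ (fun w => f w) z I))
      + conj v * ((1 / 2 : ℂ) * (fderiv ℝ (fun w => f w) z 1 + I * fderiv ℝ (fun w => f w) z I))
  rw [h]
  have h1 : (v.re : ℂ) = (v + conj v) / 2 := by rw [re_eq_add_conj]
  have h2 : (v.im : ℂ) = (v - conj v) / (2 * I) := by rw [im_eq_sub_conj]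
  have h3 : (v - conj v) / (2 * I) = - I * (v - conj v) / 2 := by
    field_simp; rw [I_sq]; ring
  rw [h1, h2, h3]
  ring

theorem dirDeriv_const (v c : ℂ) : dirDeriv τ v (algebraMap ℂ (Fn τ) c) = 0 := by
  ext z
  change fderiv ℝ (fun _ : ℂ => c) z v = 0
  simp

theorem del_one : del τ 1 = 0 := by
  have h (v : ℂ) : dirDeriv τ v 1 = 0 := by
    simpa using dirDeriv_const τ v 1
  simp [del, h]

theorem delbar_one : delbar τ 1 = 0 := by
  have h (v : ℂ) : dirDeriv τ v 1 = 0 := by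
    simpa using dirDeriv_const τ v 1
  simp [delbar, h]

/-! ### De Rham cohomology -/

/-- `d f = ∂f dz + ∂̄f dz̄`. -/
def d0 : Fn τ →ₗ[ℂ] Fn τ × Fn τ := (del τ).prod (delbar τ)

/-- `d (f dz + g dz̄) = (∂g - ∂̄f) dz ∧ dz̄`. -/
def d1 : Fn τ × Fn τ →ₗ[ℂ] Fn τ :=
  del τ ∘ₗ LinearMap.snd ℂ (Fn τ) (Fn τ) - delbar τ ∘ₗ LinearMap.fst ℂ (Fn τ) (Fn τ)

/-- Closed `1`-forms. -/
abbrev Z1 : Submodule ℂ (Fn τ × Fn τ) := LinearMap.ker (d1 τ)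

/-- Exact `1`-forms, inside the closed ones. -/
abbrev B1 : Submodule ℂ (Z1 τ) := (LinearMap.range (d0 τ)).comap (Z1 τ).subtype

/-- `H⁰_dR(E_τ)`. -/
abbrev H0 : Type := LinearMap.ker (d0 τ)

/-- `H¹_dR(E_τ)`. -/
abbrev H1 : Type := Z1 τ ⧸ B1 τ

/-- `H²_dR(E_τ)`. -/
abbrev H2 : Type := Fn τ ⧸ LinearMap.range (d1 τ)

/-- The total de Rham cohomology of `E_τ` with complex coefficients. -/
abbrev HdR : Type := H0 τ × H1 τ × H2 τ

/-! ### Integration and periods -/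

theorem Fn.continuous (f : Fn τ) : Continuous (fun z => f z) := (f.smooth τ).continuous

theorem Fn.intervalIntegrable_inner (f : Fn τ) (y : ℝ) :
    IntervalIntegrable (fun x : ℝ => f (x + y * (τ : ℂ))) MeasureTheory.volume 0 1 :=
  ((f.continuous τ).comp (by fun_prop)).intervalIntegrable _ _

theorem Fn.continuous_inner (f : Fn τ) :
    Continuous (fun y : ℝ => ∫ x in (0 : ℝ)..1, f (x + y * (τ : ℂ))) := by
  apply intervalIntegral.continuous_parametric_intervalIntegral_of_continuous'
  exact (f.continuous τ).comp
    (g := fun z => f z) (f := fun p : ℝ × ℝ => (p.2 : ℂ) + p.1 * (τ : ℂ)) (by fun_prop)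

/-- `∫_{E_τ} h dz ∧ dz̄` for the complex orientation: in the coordinates `z = x + y τ`, with
`0 ≤ x, y ≤ 1`, one has `dz ∧ dz̄ = (τ̄ - τ) dx ∧ dy`. -/
def intForm : Fn τ →ₗ[ℂ] ℂ where
  toFun h := (conj (τ : ℂ) - τ) *
    ∫ y in (0 : ℝ)..1, ∫ x in (0 : ℝ)..1, h (x + y * (τ : ℂ))
  map_add' f g := by
    have h (y : ℝ) : ∫ x in (0 : ℝ)..1, (f + g) (x + y * (τ : ℂ))
        = (∫ x in (0 : ℝ)..1, f (x + y * (τ : ℂ))) + ∫ x in (0 : ℝ)..1, g (x + y * (τ : ℂ)) :=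
      intervalIntegral.integral_add (f.intervalIntegrable_inner τ y)
        (g.intervalIntegrable_inner τ y)
    simp only [h]
    rw [intervalIntegral.integral_add ((f.continuous_inner τ).intervalIntegrable _ _)
      ((g.continuous_inner τ).intervalIntegrable _ _), mul_add]
  map_smul' c f := by
    have h (y : ℝ) : ∫ x in (0 : ℝ)..1, (c • f) (x + y * (τ : ℂ))
        = c * ∫ x in (0 : ℝ)..1, f (x + y * (τ : ℂ)) :=
      intervalIntegral.integral_const_mul c _
    simp only [h, intervalIntegral.integral_const_mul, RingHom.id_apply, smul_eq_mul]
    ring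

theorem Fn.hasDerivAt_line (f : Fn τ) (a v : ℂ) (t : ℝ) :
    HasDerivAt (fun t : ℝ => f (a + t * v)) (dirDeriv τ v f (a + t * v)) t := by
  have h1 : HasDerivAt (fun t : ℝ => a + t * v) v t := by
    simpa using ((ofRealCLM.hasDerivAt (x := t)).mul_const v).const_add a
  exact (f.differentiable τ (a + t * v)).hasFDerivAt.comp_hasDerivAt t h1

theorem Fn.integral_line (f : Fn τ) (a v : ℂ) :
    ∫ t in (0 : ℝ)..1, dirDeriv τ v f (a + t * v) = f (a + v) - f a := by
  rw [intervalIntegral.integral_eq_sub_of_hasDerivAt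
    (fun t _ => f.hasDerivAt_line τ a v t)
    ((((dirDeriv τ v f).continuous τ).comp (by fun_prop)).intervalIntegrable _ _)]
  simp

theorem intForm_dirDeriv_one (f : Fn τ) : intForm τ (dirDeriv τ 1 f) = 0 := by
  have h (y : ℝ) : ∫ x in (0 : ℝ)..1, dirDeriv τ 1 f (x + y * (τ : ℂ)) = 0 := by
    have := f.integral_line τ (y * (τ : ℂ)) 1
    rw [f.add_one, sub_self] at this
    simpa [add_comm] using this
  change (conj (τ : ℂ) - τ) * ∫ y in (0 : ℝ)..1, ∫ x in (0 : ℝ)..1,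
    dirDeriv τ 1 f (x + y * (τ : ℂ)) = 0
  simp only [h]
  simp

theorem intForm_dirDeriv_tau (f : Fn τ) : intForm τ (dirDeriv τ τ f) = 0 := by
  have h (x : ℝ) : ∫ y in (0 : ℝ)..1, dirDeriv τ τ f (x + y * (τ : ℂ)) = 0 := by
    rw [f.integral_line τ x τ, f.add_tau, sub_self]
  change (conj (τ : ℂ) - τ) * ∫ y in (0 : ℝ)..1, ∫ x in (0 : ℝ)..1,
    dirDeriv τ τ f (x + y * (τ : ℂ)) = 0
  rw [MeasureTheory.intervalIntegral_intervalIntegral_swap]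
  · simp only [h]
    simp
  · have hc : Continuous (Function.uncurry fun y x : ℝ => dirDeriv τ τ f (x + y * (τ : ℂ))) :=
      ((dirDeriv τ τ f).continuous τ).comp
        (f := fun p : ℝ × ℝ => (p.2 : ℂ) + p.1 * (τ : ℂ)) (by fun_prop)
    exact (hc.continuousOn.integrableOn_compact
      (isCompact_uIcc.prod isCompact_uIcc)).mono_set
      (Set.prod_mono Set.uIoc_subset_uIcc Set.uIoc_subset_uIcc)

/-- Every direction is a real combination of the directions `1` and `τ`. -/
theorem intForm_dirDeriv (v : ℂ) (f : Fn τ) : intForm τ (dirDeriv τ v f) = 0 := by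
  have hτ : (τ : ℂ).im ≠ 0 := τ.im_pos.ne'
  have hv : v = (v.re - v.im / (τ : ℂ).im * (τ : ℂ).re : ℝ) • (1 : ℂ)
      + (v.im / (τ : ℂ).im : ℝ) • (τ : ℂ) := by
    apply Complex.ext
    · simp
    · simp only [add_im, real_smul, im_ofReal_mul, one_im, mul_zero, zero_add]
      field_simp
  have h : dirDeriv τ v f = ((v.re - v.im / (τ : ℂ).im * (τ : ℂ).re : ℝ) : ℂ) • dirDeriv τ 1 f
      + ((v.im / (τ : ℂ).im : ℝ) : ℂ) • dirDeriv τ τ f := by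
    ext z
    change fderiv ℝ (fun w => f w) z v = _
    conv_lhs => rw [hv]
    rw [map_add, map_smul, map_smul, real_smul, real_smul]
    rfl
  rw [h, map_add, map_smul, map_smul, intForm_dirDeriv_one, intForm_dirDeriv_tau]
  simp

theorem intForm_del (f : Fn τ) : intForm τ (del τ f) = 0 := by
  simp [del, intForm_dirDeriv]

theorem intForm_delbar (f : Fn τ) : intForm τ (delbar τ f) = 0 := by
  simp [delbar, intForm_dirDeriv]

/-- Integration `H²_dR(E_τ) → ℂ`. -/
def intE : H2 τ →ₗ[ℂ] ℂ := (LinearMap.range (d1 τ)).liftQ (intForm τ) (by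
  rintro _ ⟨⟨f, g⟩, rfl⟩
  simp [d1, intForm_del, intForm_delbar])

/-- Evaluation of a class in `H⁰_dR(E_τ)` at the point `p`. -/
def evalPt (p : ℂ) : H0 τ →ₗ[ℂ] ℂ where
  toFun f := f.1 p
  map_add' _ _ := rfl
  map_smul' _ _ := rfl

/-- The integral of `f dz + g dz̄` along the straight path from `0` to `v`. -/
def pathInt (v : ℂ) : Fn τ × Fn τ →ₗ[ℂ] ℂ where
  toFun a := ∫ t in (0 : ℝ)..1, (v • a.1 + conj v • a.2) (t * v)
  map_add' a b := by
    have hI (k : Fn τ) :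
        IntervalIntegrable (fun t : ℝ => k (t * v)) MeasureTheory.volume 0 1 :=
      ((k.continuous τ).comp (by fun_prop)).intervalIntegrable _ _
    rw [← intervalIntegral.integral_add (hI _) (hI _)]
    congr 1
    funext t
    change v * (a.1 _ + b.1 _) + conj v * (a.2 _ + b.2 _)
      = (v * a.1 _ + conj v * a.2 _) + (v * b.1 _ + conj v * b.2 _)
    ring
  map_smul' c a := by
    rw [RingHom.id_apply, smul_eq_mul, ← intervalIntegral.integral_const_mul]
    congr 1
    funext t
    change v * (c * a.1 _) + conj v * (c * a.2 _) = c * (v * a.1 _ + conj v * a.2 _)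
    ring

theorem pathInt_d0 (v : ℂ) (f : Fn τ) : pathInt τ v (d0 τ f) = f v - f 0 := by
  have h := f.integral_line τ 0 v
  rw [dirDeriv_eq] at h
  simp only [zero_add] at h
  exact h

/-- The period of a class in `H¹_dR(E_τ)` along the image of the segment from `0` to the lattice
vector `v`, for `v` one of `1`, `τ`. -/
def period (v : ℂ) (hv : v = 1 ∨ v = τ) : H1 τ →ₗ[ℂ] ℂ :=
  (B1 τ).liftQ (pathInt τ v ∘ₗ (Z1 τ).subtype) (by
    rintro ⟨a, ha⟩ ⟨f, hf⟩
    have hf' : d0 τ f = a := hf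
    subst hf'
    have hv0 : f v = f 0 := by
      rcases hv with rfl | rfl
      · simpa using f.add_one τ 0
      · simpa using f.add_tau τ 0
    change pathInt τ v (d0 τ f) = 0
    rw [pathInt_d0, hv0, sub_self])

/-- The periods of a total de Rham class over the basis of `H_•(E_τ, ℤ)` given by the point `0`,
the loop `A` from `0` to `1`, the loop `B` from `0` to `τ`, and the fundamental class. These four
cycles form locally constant families in `τ`. -/
def periods : HdR τ →ₗ[ℂ] Fin 4 → ℂ :=
  LinearMap.pi ![evalPt τ 0 ∘ₗ LinearMap.fst ℂ _ _,
    period τ 1 (Or.inl rfl) ∘ₗ LinearMap.fst ℂ _ _ ∘ₗ LinearMap.snd ℂ _ _,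
    period τ τ (Or.inr rfl) ∘ₗ LinearMap.fst ℂ _ _ ∘ₗ LinearMap.snd ℂ _ _,
    intE τ ∘ₗ LinearMap.snd ℂ _ _ ∘ₗ LinearMap.snd ℂ _ _]

/-! ### Cup product and Poincaré pairing -/

/-- The cup product `H⁰ × H² → H²`. -/
def cup02 : H0 τ →ₗ[ℂ] H2 τ →ₗ[ℂ] H2 τ where
  toFun f := Submodule.mapQ _ _ (LinearMap.mulLeft ℂ f.1) (by
    rintro _ ⟨⟨g, h⟩, rfl⟩
    have hf : d0 τ f.1 = 0 := f.2
    have h1 : del τ f.1 = 0 := congrArg Prod.fst hf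
    have h2 : delbar τ f.1 = 0 := congrArg Prod.snd hf
    exact ⟨(f.1 * g, f.1 * h), by simp [d1, del_mul, delbar_mul, h1, h2, mul_sub]⟩)
  map_add' f g := by
    ext x
    simp [add_mul]
  map_smul' c f := by
    ext x
    simp

/-- `(f dz + g dz̄) ∧ (f' dz + g' dz̄) = (f g' - g f') dz ∧ dz̄`. -/
def wedge : Fn τ × Fn τ →ₗ[ℂ] Fn τ × Fn τ →ₗ[ℂ] Fn τ :=
  (LinearMap.mul ℂ (Fn τ)).compl₁₂ (LinearMap.fst ℂ _ _) (LinearMap.snd ℂ _ _)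
    - (LinearMap.mul ℂ (Fn τ)).compl₁₂ (LinearMap.snd ℂ _ _) (LinearMap.fst ℂ _ _)

theorem wedge_apply (a b : Fn τ × Fn τ) : wedge τ a b = a.1 * b.2 - a.2 * b.1 := rfl

theorem wedge_exact_left (k : Fn τ) (b : Fn τ × Fn τ) (hb : d1 τ b = 0) :
    wedge τ (d0 τ k) b ∈ LinearMap.range (d1 τ) := by
  have hb' : del τ b.2 - delbar τ b.1 = 0 := hb
  refine ⟨(k * b.1, k * b.2), ?_⟩
  change del τ (k * b.2) - delbar τ (k * b.1) = del τ k * b.2 - delbar τ k * b.1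
  rw [del_mul, delbar_mul, sub_eq_zero.1 hb']
  abel

theorem wedge_exact_right (k : Fn τ) (b : Fn τ × Fn τ) (hb : d1 τ b = 0) :
    wedge τ b (d0 τ k) ∈ LinearMap.range (d1 τ) := by
  have h : wedge τ b (d0 τ k) = - wedge τ (d0 τ k) b := by
    simp only [wedge_apply]
    ring
  rw [h]
  exact neg_mem (wedge_exact_left τ k b hb)

/-- The wedge product of closed `1`-forms, with values in `H²_dR`. -/
def wedgeClosed : Z1 τ →ₗ[ℂ] Z1 τ →ₗ[ℂ] H2 τ :=
  ((wedge τ).compl₁₂ (Z1 τ).subtype (Z1 τ).subtype).compr₂ (LinearMap.range (d1 τ)).mkQ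

/-- The cup product `H¹ × H¹ → H²`. -/
def cup11 : H1 τ →ₗ[ℂ] H1 τ →ₗ[ℂ] H2 τ :=
  ((B1 τ).liftQ
    ((B1 τ).liftQ (wedgeClosed τ) (by
      rintro ⟨a, ha⟩ ⟨k, hk⟩
      have hk' : d0 τ k = a := hk
      subst hk'
      refine LinearMap.ext fun b => ?_
      exact (Submodule.Quotient.mk_eq_zero _).2 (wedge_exact_left τ k b.1 b.2))).flip (by
    rintro ⟨a, ha⟩ ⟨k, hk⟩
    have hk' : d0 τ k = a := hk
    subst hk'
    refine LinearMap.ext fun x => ?_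
    obtain ⟨b, rfl⟩ := Submodule.Quotient.mk_surjective _ x
    exact (Submodule.Quotient.mk_eq_zero _).2 (wedge_exact_right τ k b.1 b.2))).flip

/-- The Poincaré pairing `⟨x, y⟩_P = ∫ x ∪ y` on the total cohomology. -/
def poincare (x y : HdR τ) : ℂ :=
  intE τ (cup02 τ x.1 y.2.2 + cup11 τ x.2.1 y.2.1 + cup02 τ y.1 x.2.2)

/-! ### Hochschild homology through Dolbeault cohomology

By the Hochschild-Kostant-Rosenberg isomorphism `HH_n(E_τ) = ⨁_{q - p = n} Hᵖ(E_τ, Ω^q)`, and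
`Hᵖ(E_τ, Ω^q)` is the cohomology of the Dolbeault complex of `(q, p)`-forms. The forms of type
`(0,0)`, `(1,0)`, `(0,1)`, `(1,1)` are `f`, `f dz`, `f dz̄`, `f dz ∧ dz̄`, and `∂̄` sends
`f` to `(∂̄f) dz̄` and `f dz` to `-(∂̄f) dz ∧ dz̄`. -/

/-- `H⁰(E_τ, Ω^q)`, for `q = 0, 1`: functions `f`, respectively forms `f dz`, with `∂̄f = 0`. -/
abbrev Dol0 : Type := LinearMap.ker (delbar τ)

/-- `H¹(E_τ, Ω^q)`, for `q = 0, 1`: forms `g dz̄`, respectively `g dz ∧ dz̄`, modulo the image of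
`∂̄`. -/
abbrev Dol1 : Type := Fn τ ⧸ LinearMap.range (delbar τ)

/-- `HH_1(E_τ) = H⁰(E_τ, Ω¹)`. -/
abbrev HHone : Type := Dol0 τ

/-- `HH_0(E_τ) = H⁰(E_τ, 𝒪) ⊕ H¹(E_τ, Ω¹)`. -/
abbrev HHzero : Type := Dol0 τ × Dol1 τ

/-- `HH_{-1}(E_τ) = H¹(E_τ, 𝒪)`. -/
abbrev HHminusOne : Type := Dol1 τ

/-- The total Hochschild homology `HH_1 ⊕ HH_0 ⊕ HH_{-1}`. -/
abbrev HH : Type := HHone τ × HHzero τ × HHminusOne τ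

/-- The pairing `(f, [g]) ↦ ∫_{E_τ} f g dz ∧ dz̄`. -/
def serre (f : Dol0 τ) : Dol1 τ →ₗ[ℂ] ℂ :=
  (LinearMap.range (delbar τ)).liftQ (intForm τ ∘ₗ LinearMap.mulLeft ℂ f.1) (by
    rintro _ ⟨k, rfl⟩
    have hf : delbar τ f.1 = 0 := f.2
    have h : delbar τ (f.1 * k) = f.1 * delbar τ k := by rw [delbar_mul, hf, zero_mul, add_zero]
    change intForm τ (f.1 * delbar τ k) = 0
    rw [← h, intForm_delbar])

/-- The Mukai pairing `⟨u, v⟩_M = (1 / 2πi) ∫_{E_τ} (-1)^{|u|} u ∧ v`, where `|u| = q` for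
`u ∈ Hᵖ(E_τ, Ω^q)`. With `u = (a dz, (b, c dz ∧ dz̄), e dz̄)` and the same letters with primes
for `v`, the `(1,1)`-part of `(-1)^{|u|} u ∧ v` is the sum of
`- (a dz) ∧ (e' dz̄)`, `(b) ∧ (c' dz ∧ dz̄)`, `- (c dz ∧ dz̄) ∧ (b')` and
`(e dz̄) ∧ (a' dz) = - a' e dz ∧ dz̄`. -/
def mukai (u v : HH τ) : ℂ :=
  1 / (2 * Real.pi * I) *
    (- serre τ u.1 v.2.2 + serre τ u.2.1.1 v.2.1.2 - serre τ v.2.1.1 u.2.1.2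
      - serre τ v.1 u.2.2)

/-! ### The Hodge filtration -/

/-- `HH_1 = H⁰(E_τ, Ω¹) → H¹_dR(E_τ)`, `f dz ↦ [f dz]`. Its image is the Hodge filtration
step `F¹ H¹_dR(E_τ)`. -/
def hodgeIncl : HHone τ →ₗ[ℂ] H1 τ where
  toFun f := (B1 τ).mkQ ⟨(f.1, 0), by
    have hf : delbar τ f.1 = 0 := f.2
    simp [d1, hf]⟩
  map_add' f g := by
    rw [← map_add]
    congr 1
    ext1
    simp
  map_smul' c f := by
    rw [RingHom.id_apply, ← map_smul]
    congr 1
    ext1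
    simp

/-- `H¹_dR(E_τ) → H¹(E_τ, 𝒪) = HH_{-1}`, `[f dz + g dz̄] ↦ [g dz̄]`. -/
def hodgeProj : H1 τ →ₗ[ℂ] HHminusOne τ :=
  Submodule.mapQ _ _ (LinearMap.snd ℂ _ _ ∘ₗ (Z1 τ).subtype) (by
    rintro ⟨a, ha⟩ ⟨k, hk⟩
    have hk' : d0 τ k = a := hk
    subst hk'
    exact ⟨k, rfl⟩)

/-- `H⁰_dR(E_τ) → H⁰(E_τ, 𝒪)`, `[f] ↦ [f]`. -/
def hodgeZero : H0 τ →ₗ[ℂ] Dol0 τ :=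
  Submodule.inclusion (fun _ hf => congrArg Prod.snd hf)

/-- `H¹(E_τ, Ω¹) → H²_dR(E_τ)`, `[g dz ∧ dz̄] ↦ [g dz ∧ dz̄]`. -/
def hodgeTwo : Dol1 τ →ₗ[ℂ] H2 τ :=
  Submodule.mapQ _ _ LinearMap.id (by
    rintro _ ⟨k, rfl⟩
    exact ⟨(-k, 0), by simp [d1]⟩)

/-! ### The A-model

The torus `Ě = ℝ²/ℤ²`, with some complex structure, is `E_σ` for some `σ`. -/

/-- `1 ∈ H⁰(Ě)`. -/
def oneClass (σ : ℍ) : H0 σ := ⟨1, by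
  simp [d0, del_one, delbar_one]⟩

/-- `[pt]^PD ∈ H²(Ě)`: the class of the form `dx ∧ dy` in the coordinates `z = x + y σ`. -/
def ptClass (σ : ℍ) : H2 σ :=
  Submodule.Quotient.mk (algebraMap ℂ (Fn σ) (1 / (conj (σ : ℂ) - σ)))

/-- `ptClass` is Poincaré dual to every point. -/
theorem poincare_ptClass (σ : ℍ) (p : ℂ) (f : H0 σ) :
    poincare σ (f, 0, 0) (0, 0, ptClass σ) = evalPt σ p f := by
  have hd : d0 σ f.1 = 0 := f.2
  have h1 : del σ f.1 = 0 := congrArg Prod.fst hd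
  have h2 : delbar σ f.1 = 0 := congrArg Prod.snd hd
  have hc (z : ℂ) : f.1 z = f.1 p := by
    refine is_const_of_fderiv_eq_zero (𝕜 := ℝ) (f.1.differentiable σ) (fun w => ?_) z p
    refine ContinuousLinearMap.ext fun v => ?_
    have h := congrArg (fun k : Fn σ => k w) (dirDeriv_eq σ v f.1)
    rw [h1, h2, smul_zero, smul_zero, add_zero] at h
    exact h
  have hne : conj (σ : ℂ) - σ ≠ 0 := by
    intro h
    have := congrArg Complex.im h
    simp only [sub_im, conj_im, zero_im] at this
    have hp : 0 < (σ : ℂ).im := σ.im_pos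
    linarith
  have hm : poincare σ (f, 0, 0) (0, 0, ptClass σ)
      = intForm σ (f.1 * algebraMap ℂ (Fn σ) (1 / (conj (σ : ℂ) - σ))) := by
    simp only [poincare, map_zero, add_zero]
    rfl
  rw [hm]
  change (conj (σ : ℂ) - σ) * ∫ y in (0 : ℝ)..1, ∫ x in (0 : ℝ)..1,
    f.1 (x + y * (σ : ℂ)) * (1 / (conj (σ : ℂ) - σ)) = f.1 p
  simp only [hc]
  simp
  field_simp

/-- `ω dz ∧ dz̄` is a symplectic form of area one on `Ě = E_σ`: it is real and nowhere zero, and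
its integral is one. -/
def IsSymplecticOfAreaOne (σ : ℍ) (ω : Fn σ) : Prop :=
  (∀ z, ∃ r : ℝ, r ≠ 0 ∧ ω z * (conj (σ : ℂ) - σ) = r) ∧ intForm σ ω = 1

/-- The cup product `x ∪ [ω]` with the class of a `2`-form. -/
def cupOmega (σ : ℍ) (ω : Fn σ) (x : HdR σ) : HdR σ :=
  (0, 0, cup02 σ x.1 (Submodule.Quotient.mk ω))

/-- The section `s` of the trivial bundle with fibre `H^•(Ě, ℂ)` over the `q`-plane is complex
differentiable at `q` with derivative `s'`. As the fibre has finite dimension this is tested on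
linear functionals. -/
def HasSectionDeriv {σ : ℍ} (s : ℂ → HdR σ) (s' : HdR σ) (q : ℂ) : Prop :=
  ∀ l : HdR σ →ₗ[ℂ] ℂ, HasDerivAt (fun q' => l (s q')) (l s') q

/-- The Dubrovin connection `∇^D_{q∂_q} s = q ∂_q s - s ∪ [ω]`: the section `s` is differentiable
at `q`, and the value of `∇^D_{q∂_q} s` at `q` is `t`. -/
def HasDubrovin {σ : ℍ} (ω : Fn σ) (s : ℂ → HdR σ) (t : HdR σ) (q : ℂ) : Prop :=
  ∃ s', HasSectionDeriv s s' q ∧ t = q • s' - cupOmega σ ω (s q)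

/-! ### The B-model connection and the mirror map -/

variable {τ}

/-- The Gauss-Manin connection: the family `α` of de Rham classes of the curves `E_τ` is
differentiable at `τ` and `∇^GM_{∂_τ} α = β` there. The flat sections are those with constant
periods over locally constant families of cycles, so the periods of `β` are the derivatives of the
periods of `α`. -/
def HasGaussManin (α : ∀ τ : ℍ, HdR τ) (τ : ℍ) (β : HdR τ) : Prop :=
  ∀ i, HasDerivAt (fun w : ℂ => periods (UpperHalfPlane.ofComplex w)
    (α (UpperHalfPlane.ofComplex w)) i) (periods τ β i) (τ : ℂ)

/-- The exponential coordinate `q = exp (2πi ρ)`, where `ρ = τ` under the mirror map. -/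
def qCoord (τ : ℍ) : ℂ := exp (2 * Real.pi * I * τ)

/-- The lattices of `τ` and `τ' = τ + 1` agree, so `E_τ` and `E_τ'` are the same curve, with the
same forms. The class `x` of `E_τ` and the class `y` of `E_τ'` are equal under this identification
if they are represented by the same forms `f₀`, `a.1 dz + a.2 dz̄`, `h dz ∧ dz̄`. -/
def SameClass {τ τ' : ℍ} (x : HdR τ) (y : HdR τ') : Prop :=
  ∃ (a : Z1 τ) (h : Fn τ) (a' : Z1 τ') (h' : Fn τ'),
    x.2 = (Submodule.Quotient.mk a, Submodule.Quotient.mk h) ∧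
    y.2 = (Submodule.Quotient.mk a', Submodule.Quotient.mk h') ∧
    ∀ z, x.1.1 z = y.1.1 z ∧ a.1.1 z = a'.1.1 z ∧ a.1.2 z = a'.1.2 z ∧ h z = h' z

/-- The class `x ∈ H⁰(Ě)` corresponds to `u ∈ HH_1(E_τ)` under `φ`: the image of `x` lies in the
Hodge filtration and equals `u` there. -/
def CorrOne {σ τ : ℍ} (φ : HdR σ ≃ₗ[ℂ] HdR τ) (x : H0 σ) (u : HHone τ) : Prop :=
  φ (x, 0, 0) = (0, hodgeIncl τ u, 0)

/-- The class `x ∈ H¹(Ě)` corresponds to `u ∈ HH_0(E_τ)` under `φ`. -/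
def CorrZero {σ τ : ℍ} (φ : HdR σ ≃ₗ[ℂ] HdR τ) (x : H1 σ) (u : HHzero τ) : Prop :=
  ∃ b : H0 τ, hodgeZero τ b = u.1 ∧ φ (0, x, 0) = (b, 0, hodgeTwo τ u.2)

/-- The class `x ∈ H²(Ě)` corresponds to `u ∈ HH_{-1}(E_τ)` under `φ`: the image of `x` in
`H¹_dR(E_τ)` is a lift of `u`. -/
def CorrMinusOne {σ τ : ℍ} (φ : HdR σ ≃ₗ[ℂ] HdR τ) (x : H2 σ) (u : HHminusOne τ) : Prop :=
  ∃ y : H1 τ, φ (0, 0, x) = (0, y, 0) ∧ hodgeProj τ y = u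

/-- The correspondence between `H^{1-•}(Ě)` and `HH_•(E_τ)` induced by a filtered isomorphism
`φ` of `H^•(Ě)` with `H^•_dR(E_τ)` on associated graded spaces. -/
def Corr {σ τ : ℍ} (φ : HdR σ ≃ₗ[ℂ] HdR τ) (x : HdR σ) (u : HH τ) : Prop :=
  CorrOne φ x.1 u.1 ∧ CorrZero φ x.2.1 u.2.1 ∧ CorrMinusOne φ x.2.2 u.2.2

/-- `Φ` is an isomorphism, over the neighbourhood `Im τ > R` of the cusp and along the mirror map
`ρ = τ`, from the A-model variation with fibre `H^•(Ě, ℂ)` to the B-model variation with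
fibre `H^•_dR(E_τ)`. -/
structure IsMirrorIso {σ : ℍ} (ω : Fn σ) (R : ℝ) (Φ : ∀ τ : ℍ, HdR σ ≃ₗ[ℂ] HdR τ) : Prop where
  /-- `Φ` exchanges even and odd classes. -/
  even_to_odd : ∀ τ : ℍ, R < τ.im → ∀ a c, (Φ τ (a, 0, c)).1 = 0 ∧ (Φ τ (a, 0, c)).2.2 = 0
  odd_to_even : ∀ τ : ℍ, R < τ.im → ∀ b, (Φ τ (0, b, 0)).2.1 = 0
  /-- `Φ` identifies the filtration step `H⁰(Ě) ⊆ H⁰(Ě) ⊕ H²(Ě)` with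
  `H⁰(E_τ, Ω¹) ⊆ H¹_dR(E_τ)`. -/
  filtration : ∀ τ : ℍ, R < τ.im → ∀ x : HdR σ,
    (∃ a, x = (a, 0, 0)) ↔ ∃ u, Φ τ x = (0, hodgeIncl τ u, 0)
  /-- `Φ` is invariant under `τ ↦ τ + 1`, so it is defined over the `q`-disc. -/
  monodromy : ∀ τ τ' : ℍ, R < τ.im → (τ' : ℂ) = τ + 1 → ∀ x, SameClass (Φ τ x) (Φ τ' x)
  /-- `Φ` maps `∇^D_{q∂_q}` to `∇^GM_{q∂_q}`, where `q∂_q = (1 / 2πi) ∂_τ`. -/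
  connection : ∀ τ : ℍ, R < τ.im → ∀ (s : ℂ → HdR σ) (t : HdR σ),
    HasDubrovin ω s t (qCoord τ) →
    ∃ β : HdR τ, HasGaussManin (fun τ' => Φ τ' (s (qCoord τ'))) τ β ∧
      Φ τ t = (1 / (2 * Real.pi * I) : ℂ) • β
  /-- `Φ` maps the Poincaré pairing to the Mukai pairing. -/
  pairing : ∀ τ : ℍ, R < τ.im → ∀ (x y : HdR σ) (u v : HH τ),
    Corr (Φ τ) x u → Corr (Φ τ) y v → mukai τ u v = poincare σ x y

/-- `[Ω] = [2πi dz] ∈ HH_1(E_τ)`. -/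
def OmegaClass (τ : ℍ) : HHone τ :=
  (2 * Real.pi * I : ℂ) • ⟨1, delbar_one τ⟩

/-- `[ξ] = [dz̄] / (τ - τ̄) ∈ HH_{-1}(E_τ)`. -/
def xiClass (τ : ℍ) : HHminusOne τ :=
  (1 / ((τ : ℂ) - conj (τ : ℂ))) • Submodule.Quotient.mk 1

end

end EllipticMirror

namespace EllipticMirror

open Complex
open scoped UpperHalfPlane ComplexConjugate

noncomputable section

section

/-! ### Weighted averages along lines -/

/-! Everything is computed in periods. Integrating over a point, the loops `A` and `B`, and the
fundamental class identifies `HdR τ` with `Fin 4 → ℂ`. Surjectivity comes from constant-coefficient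
forms. Injectivity (`periods_injective`) is the de Rham theorem for a torus, proved with explicit
primitives: the weighted average `∫₀¹ t f(z + t v) dt` along a period `v` is again smooth and doubly
periodic, and its `v`-derivative is `f` minus its mean.

In period coordinates Gauss-Manin is plain differentiation, the Hodge line is spanned by `(1, τ)` in
the `A` and `B` entries, and both pairings are explicit bilinear forms (`poincare_eq_periods`,
`mukai_eq`). Existence is then a check on the explicit matrix `periodMap`.

For the sign, apply the connection to the constant sections `1` and `[pt]`, where `∇^D 1 = -[pt]`
and `∇^D [pt] = 0`. The image of `[pt]` has locally constant periods `(q₁, q₂)`, while that of `1`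
has periods `(p, pτ)` with derivative `-2πi (q₁, q₂)`. Differentiating twice forces `q₁ = 0`, `p`
constant and `-2πi q₂ = p` (`const_of_hasDerivAt`). The pairing of `1` with `[pt]` gives `-p q₂ =
2πi`, so `p² = (2πi)²`. Connectedness of the half-plane makes the sign of `p = ±2πi` independent of
`τ`. -/

theorem hasFDerivAt_integral_translate {F : Type} [NormedAddCommGroup F] [NormedSpace ℝ F]
    {φ : ℝ → ℝ} (hφ : Continuous φ) (v : ℂ) {f : ℂ → F} (hf : ContDiff ℝ 1 f) (z₀ : ℂ) :
    HasFDerivAt (fun z => ∫ t in (0 : ℝ)..1, φ t • f (z + t * v))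
      (∫ t in (0 : ℝ)..1, φ t • fderiv ℝ f (z₀ + t * v)) z₀ := by
  have hf' : Continuous (fderiv ℝ f) := hf.continuous_fderiv (by simp)
  have hc : Continuous f := hf.continuous
  have hd : Differentiable ℝ f := hf.differentiable (by simp)
  obtain ⟨C, hC⟩ := ((isCompact_closedBall z₀ 1).prod
    (isCompact_uIcc (a := (0 : ℝ)) (b := 1))).exists_bound_of_continuousOn
    (f := fun p : ℂ × ℝ => φ p.2 • fderiv ℝ f (p.1 + p.2 * v))
    (by fun_prop)
  refine intervalIntegral.hasFDerivAt_integral_of_dominated_of_fderiv_le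
    (F' := fun z t => φ t • fderiv ℝ f (z + t * v)) (bound := fun _ => C)
    (Metric.closedBall_mem_nhds z₀ one_pos) ?_ ?_ ?_ ?_ ?_ ?_
  · exact .of_forall fun z => (by fun_prop : Continuous _).aestronglyMeasurable
  · exact (by fun_prop : Continuous _).intervalIntegrable _ _
  · have : SecondCountableTopologyEither ℝ (ℂ →L[ℝ] F) := secondCountableTopologyEither_of_left _ _
    exact (by fun_prop : Continuous _).aestronglyMeasurable
  · exact .of_forall fun t ht z hz => hC (z, t) ⟨hz, Set.uIoc_subset_uIcc ht⟩
  · exact intervalIntegrable_const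
  · refine .of_forall fun t _ z _ => ?_
    have h := (hd (z + t * v)).hasFDerivAt.comp z ((hasFDerivAt_id z).add_const (t * v))
    exact h.const_smul (φ t)

/-- Differentiation under the integral yields an average of the same shape for `fderiv ℝ f`. The
induction must therefore quantify over the target space `F`, which changes at each step. -/
theorem contDiff_integral_translate {φ : ℝ → ℝ} (hφ : Continuous φ) (v : ℂ) (n : ℕ) :
    ∀ {F : Type} [NormedAddCommGroup F] [NormedSpace ℝ F] {f : ℂ → F},
      ContDiff ℝ (⊤ : ℕ∞) f →
      ContDiff ℝ n (fun z => ∫ t in (0 : ℝ)..1, φ t • f (z + t * v)) := by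
  have h1 {F : Type} [NormedAddCommGroup F] [NormedSpace ℝ F] {f : ℂ → F}
      (hf : ContDiff ℝ (⊤ : ℕ∞) f) := hasFDerivAt_integral_translate hφ v
        (hf.of_le (by exact_mod_cast le_top))
  induction n with
  | zero =>
    intro F _ _ f hf
    exact contDiff_zero.2 (continuous_iff_continuousAt.2 fun z => (h1 hf z).continuousAt)
  | succ n ih =>
    intro F _ _ f hf
    refine (contDiff_succ_iff_hasFDerivAt (n := n)).2 ⟨_, ih (f := fderiv ℝ f) ?_, h1 hf⟩
    exact hf.fderiv_right (m := (⊤ : ℕ∞)) (by simp)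

variable (τ : ℍ)

/-- The weighted average `z ↦ ∫₀¹ φ(t) f(z + t v) dt`. -/
def avg (φ : C(ℝ, ℝ)) (v : ℂ) (f : Fn τ) : Fn τ :=
  ⟨fun z => ∫ t in (0 : ℝ)..1, φ t • f (z + t * v),
    contDiff_infty.2 fun n => contDiff_integral_translate φ.continuous v n (f.smooth τ),
    fun z => by simp only [add_right_comm z 1, f.add_one],
    fun z => by simp only [add_right_comm z (τ : ℂ), f.add_tau]⟩

theorem avg_apply (φ : C(ℝ, ℝ)) (v : ℂ) (f : Fn τ) (z : ℂ) :
    avg τ φ v f z = ∫ t in (0 : ℝ)..1, φ t • f (z + t * v) := rfl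

theorem avg_zero (φ : C(ℝ, ℝ)) (v : ℂ) : avg τ φ v 0 = 0 := by
  ext z
  rw [avg_apply]
  change ∫ t in (0 : ℝ)..1, φ t • (0 : ℂ) = 0
  simp

theorem dirDeriv_avg (φ : C(ℝ, ℝ)) (v w : ℂ) (f : Fn τ) :
    dirDeriv τ w (avg τ φ v f) = avg τ φ v (dirDeriv τ w f) := by
  have hs : ContDiff ℝ 1 (fun z => f z) := (f.smooth τ).of_le (by exact_mod_cast le_top)
  have hφ := φ.continuous
  have hc : Continuous (fderiv ℝ (fun z => f z)) := hs.continuous_fderiv (by simp)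
  ext z
  change fderiv ℝ (fun z => ∫ t in (0 : ℝ)..1, φ t • f (z + t * v)) z w
    = ∫ t in (0 : ℝ)..1, φ t • fderiv ℝ (fun z => f z) (z + t * v) w
  rw [(hasFDerivAt_integral_translate hφ v hs z).fderiv,
    ContinuousLinearMap.intervalIntegral_apply ((by fun_prop : Continuous _).intervalIntegrable _ _)]
  rfl

/-- The translation invariant mean along a lattice direction. -/
def mean (v : ℂ) (f : Fn τ) : Fn τ := avg τ 1 v f

/-- A primitive along `v` of `f - mean v f`, for `v` a period of the lattice. -/
def primitive (v : ℂ) (f : Fn τ) : Fn τ := avg τ (.id ℝ) v f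

theorem dirDeriv_mean (v w : ℂ) (f : Fn τ) :
    dirDeriv τ w (mean τ v f) = mean τ v (dirDeriv τ w f) := dirDeriv_avg τ 1 v w f

theorem dirDeriv_primitive (v w : ℂ) (f : Fn τ) :
    dirDeriv τ w (primitive τ v f) = primitive τ v (dirDeriv τ w f) := dirDeriv_avg τ _ v w f

theorem mean_zero (v : ℂ) : mean τ v 0 = 0 := avg_zero τ 1 v

theorem primitive_zero (v : ℂ) : primitive τ v 0 = 0 := avg_zero τ _ v

variable {τ}

theorem mean_apply (v : ℂ) (f : Fn τ) (z : ℂ) :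
    mean τ v f z = ∫ t in (0 : ℝ)..1, f (z + t * v) := by
  simp [mean, avg_apply]

theorem Fn.add_period {v : ℂ} (hv : v = 1 ∨ v = τ) (f : Fn τ) (z : ℂ) : f (z + v) = f z := by
  rcases hv with rfl | rfl
  exacts [f.add_one τ z, f.add_tau τ z]

theorem mean_dirDeriv {v : ℂ} (hv : v = 1 ∨ v = τ) (f : Fn τ) :
    mean τ v (dirDeriv τ v f) = 0 := by
  ext z
  rw [mean_apply, f.integral_line, f.add_period hv, sub_self]
  rfl

/-- Integration by parts against the weight `t`: periodicity turns the boundary term `f (z + v)`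
into `f z`. -/
theorem primitive_dirDeriv {v : ℂ} (hv : v = 1 ∨ v = τ) (f : Fn τ) :
    primitive τ v (dirDeriv τ v f) = f - mean τ v f := by
  ext z
  change _ = f z - mean τ v f z
  rw [mean_apply, primitive, avg_apply]
  have h := intervalIntegral.integral_mul_deriv_eq_deriv_mul (a := 0) (b := 1)
    (u := fun t : ℝ => (t : ℂ)) (u' := fun _ => 1) (v := fun t : ℝ => f (z + t * v))
    (v' := fun t : ℝ => dirDeriv τ v f (z + t * v))
    (fun t _ => ofRealCLM.hasDerivAt) (fun t _ => f.hasDerivAt_line τ z v t)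
    intervalIntegrable_const
    ((((dirDeriv τ v f).continuous τ).comp (by fun_prop)).intervalIntegrable _ _)
  simpa [f.add_period hv] using h

/-- The directions `1` and `τ` span `ℂ` over `ℝ`, so the whole differential vanishes. -/
theorem Fn.eq_const {f : Fn τ} (h1 : dirDeriv τ 1 f = 0) (h2 : dirDeriv τ τ f = 0) (z : ℂ) :
    f z = f 0 := by
  have hτ : (τ : ℂ).im ≠ 0 := τ.im_pos.ne'
  refine is_const_of_fderiv_eq_zero (𝕜 := ℝ) (f.differentiable τ) (fun w => ?_) z 0
  refine ContinuousLinearMap.ext fun v => ?_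
  have hv : v = (v.re - v.im / (τ : ℂ).im * (τ : ℂ).re : ℝ) • (1 : ℂ)
      + (v.im / (τ : ℂ).im : ℝ) • (τ : ℂ) := by
    apply Complex.ext
    · simp
    · simp only [add_im, real_smul, im_ofReal_mul, one_im, mul_zero, zero_add]
      field_simp
  have e1 : fderiv ℝ (fun w => f w) w 1 = 0 := congrArg (fun k : Fn τ => k w) h1
  have e2 : fderiv ℝ (fun w => f w) w τ = 0 := congrArg (fun k : Fn τ => k w) h2
  rw [hv, map_add, map_smul, map_smul, e1, e2]
  simp

/-! ### Forms with vanishing periods are exact -/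

theorem dirDeriv_mem_range_d1 (v : ℂ) (f : Fn τ) :
    dirDeriv τ v f ∈ LinearMap.range (d1 τ) := by
  -- Cartan's formula: the primitive is the contraction of `f dz ∧ dz̄` with `v`.
  refine ⟨(-(conj v • f), v • f), ?_⟩
  rw [dirDeriv_eq]
  simp [d1]

variable (τ) in
theorem sub_conj_ne_zero : (τ : ℂ) - conj (τ : ℂ) ≠ 0 := by
  intro h
  have h' := congrArg Complex.im h
  simp only [sub_im, conj_im, zero_im] at h'
  have hp : 0 < (τ : ℂ).im := τ.im_pos
  linarith

variable (τ) in
theorem conj_sub_ne_zero : conj (τ : ℂ) - τ ≠ 0 := by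
  rw [← neg_sub]
  exact neg_ne_zero.2 (sub_conj_ne_zero τ)

/-- Subtract the mean along `1`, then the mean of the rest along `τ`. Each difference is a
directional derivative, hence exact, and the final double mean is a constant proportional to
`intForm τ h`. -/
theorem mem_range_d1 {h : Fn τ} (hh : intForm τ h = 0) : h ∈ LinearMap.range (d1 τ) := by
  have h1 : (1 : ℂ) = 1 ∨ (1 : ℂ) = τ := Or.inl rfl
  have h2 : (τ : ℂ) = 1 ∨ (τ : ℂ) = τ := Or.inr rfl
  have e1 := primitive_dirDeriv h1 h
  have e2 := primitive_dirDeriv h2 (mean τ 1 h)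
  have hz : mean τ τ (mean τ 1 h) = 0 := by
    ext z
    rw [Fn.eq_const (f := mean τ τ (mean τ 1 h))]
    · rw [mean_apply]
      simp only [mean_apply]
      have := (mul_eq_zero.1 hh).resolve_left (conj_sub_ne_zero τ)
      simp only [zero_add, mul_one]
      simp only [add_comm (((_ : ℝ) : ℂ) * (τ : ℂ))]
      exact this
    · rw [dirDeriv_mean, dirDeriv_mean, mean_dirDeriv h1, mean_zero]
    · rw [dirDeriv_mean, mean_dirDeriv h2]
  rw [hz, sub_zero, ← dirDeriv_primitive] at e2
  rw [← dirDeriv_primitive] at e1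
  rw [← sub_add_cancel h (mean τ 1 h), ← e1, ← e2]
  exact add_mem (dirDeriv_mem_range_d1 _ _) (dirDeriv_mem_range_d1 _ _)

/-- This is `da(v, w) = 0` for the constant, hence commuting, vector fields `v` and `w`. -/
theorem dirDeriv_comm_of_closed {a : Fn τ × Fn τ} (ha : d1 τ a = 0) (v w : ℂ) :
    dirDeriv τ v (w • a.1 + conj w • a.2) = dirDeriv τ w (v • a.1 + conj v • a.2) := by
  have ha' : del τ a.2 = delbar τ a.1 := sub_eq_zero.1 ha
  simp only [dirDeriv_eq, map_add, map_smul, ha']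
  module

theorem ext_of_dirDeriv {a b : Fn τ × Fn τ} (h1 : a.1 + a.2 = b.1 + b.2)
    (h2 : (τ : ℂ) • a.1 + conj (τ : ℂ) • a.2 = (τ : ℂ) • b.1 + conj (τ : ℂ) • b.2) : a = b := by
  have e1 : ((τ : ℂ) - conj (τ : ℂ)) • a.1 = ((τ : ℂ) - conj (τ : ℂ)) • b.1 := by
    linear_combination (norm := module) h2 - conj (τ : ℂ) • h1
  have e1' : a.1 = b.1 := smul_right_injective _ (sub_conj_ne_zero τ) e1
  rw [e1', add_right_inj] at h1
  exact Prod.ext e1' h1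

theorem del_add_delbar (f : Fn τ) : del τ f + delbar τ f = dirDeriv τ 1 f := by
  rw [dirDeriv_eq]
  simp

/-- Evaluate the form on the directions `1` and `τ` to get `A` and `B`. The primitive `g` of `A`
along `1` already has `τ`-derivative `B` up to `mean τ 1 B`. That error is constant along `1`, so a
primitive along `τ` corrects it without disturbing the `1`-derivative. -/
theorem mem_range_d0 {a : Fn τ × Fn τ} (ha : d1 τ a = 0) (h1 : pathInt τ 1 a = 0)
    (h2 : pathInt τ τ a = 0) : a ∈ LinearMap.range (d0 τ) := by
  have l1 : (1 : ℂ) = 1 ∨ (1 : ℂ) = τ := Or.inl rfl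
  have l2 : (τ : ℂ) = 1 ∨ (τ : ℂ) = τ := Or.inr rfl
  set A := (1 : ℂ) • a.1 + conj (1 : ℂ) • a.2 with hA
  set B := (τ : ℂ) • a.1 + conj (τ : ℂ) • a.2 with hB
  have hAB : dirDeriv τ τ A = dirDeriv τ 1 B := dirDeriv_comm_of_closed ha _ _
  have p1 : ∫ t in (0 : ℝ)..1, A (t * 1) = 0 := h1
  have p2 : ∫ t in (0 : ℝ)..1, B (t * τ) = 0 := h2
  have mA : mean τ 1 A = 0 := by
    ext z
    rw [Fn.eq_const (f := mean τ 1 A)]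
    · rw [mean_apply]
      simp only [zero_add]
      exact p1
    · rw [dirDeriv_mean, mean_dirDeriv l1]
    · rw [dirDeriv_mean, hAB, mean_dirDeriv l1]
  set g := primitive τ 1 A
  have g1 : dirDeriv τ 1 g = A := by
    rw [dirDeriv_primitive, primitive_dirDeriv l1, mA, sub_zero]
  have g2 : dirDeriv τ τ g = B - mean τ 1 B := by
    rw [dirDeriv_primitive, hAB, primitive_dirDeriv l1]
  have n1 : dirDeriv τ 1 (mean τ 1 B) = 0 := by
    rw [dirDeriv_mean, mean_dirDeriv l1]
  -- The double mean is constant; at `0` it is the `τ`-period of the form minus the integral of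
  -- `dirDeriv τ τ g` over a closed loop.
  have mB : mean τ τ (mean τ 1 B) = 0 := by
    ext z
    rw [Fn.eq_const (f := mean τ τ (mean τ 1 B))]
    · have e (w : ℂ) : mean τ 1 B w = B w - dirDeriv τ τ g w := by
        rw [g2]
        exact (sub_sub_cancel (B w) (mean τ 1 B w)).symm
      rw [mean_apply]
      simp only [e, zero_add]
      have hI (k : Fn τ) :
          IntervalIntegrable (fun t : ℝ => k (t * τ)) MeasureTheory.volume 0 1 :=
        ((k.continuous τ).comp (by fun_prop)).intervalIntegrable _ _
      rw [intervalIntegral.integral_sub (hI B) (hI (dirDeriv τ τ g)), p2]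
      have := g.integral_line τ 0 τ
      simp only [zero_add] at this
      have hg := g.add_tau τ 0
      rw [zero_add] at hg
      rw [this, hg, sub_self, sub_self]
      rfl
    · rw [dirDeriv_mean, n1, mean_zero]
    · rw [dirDeriv_mean, mean_dirDeriv l2]
  have k1 : dirDeriv τ 1 (primitive τ τ (mean τ 1 B)) = 0 := by
    rw [dirDeriv_primitive, n1, primitive_zero]
  have k2 : dirDeriv τ τ (primitive τ τ (mean τ 1 B)) = mean τ 1 B := by
    rw [dirDeriv_primitive, primitive_dirDeriv l2, mB, sub_zero]
  refine ⟨g + primitive τ τ (mean τ 1 B), ext_of_dirDeriv ?_ ?_⟩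
  · change del τ _ + delbar τ _ = _
    rw [del_add_delbar, map_add, g1, k1, hA]
    simp
  · change (τ : ℂ) • del τ _ + conj (τ : ℂ) • delbar τ _ = B
    rw [← dirDeriv_eq, map_add, g2, k2, sub_add_cancel]

end

section

variable {τ : ℍ}

/-! ### Constant functions and forms -/

variable (τ) in
/-- The constant function `c`. -/
def const (c : ℂ) : Fn τ := algebraMap ℂ (Fn τ) c

theorem const_eq_smul_one (c : ℂ) : const τ c = c • 1 := Algebra.algebraMap_eq_smul_one c

theorem del_const (c : ℂ) : del τ (const τ c) = 0 := by
  rw [const_eq_smul_one, map_smul, del_one, smul_zero]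

theorem delbar_const (c : ℂ) : delbar τ (const τ c) = 0 := by
  rw [const_eq_smul_one, map_smul, delbar_one, smul_zero]

theorem intForm_const (c : ℂ) : intForm τ (const τ c) = c * (conj (τ : ℂ) - τ) := by
  change (conj (τ : ℂ) - τ) * ∫ _ in (0 : ℝ)..1, ∫ _ in (0 : ℝ)..1, c = _
  simp [mul_comm]

theorem intForm_const_mul (c : ℂ) (h : Fn τ) : intForm τ (const τ c * h) = c * intForm τ h := by
  rw [const_eq_smul_one, smul_one_mul, map_smul, smul_eq_mul]

/-- All values are attained on the compact fundamental parallelogram. -/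
theorem Fn.isBounded_range (f : Fn τ) : Bornology.IsBounded (Set.range (fun z => f z)) := by
  have hc : IsCompact ((fun p : ℝ × ℝ => f (p.1 + p.2 * (τ : ℂ))) ''
      (Set.Icc 0 1 ×ˢ Set.Icc 0 1)) :=
    (isCompact_Icc.prod isCompact_Icc).image ((f.continuous τ).comp (by fun_prop))
  refine hc.isBounded.subset ?_
  rintro _ ⟨z, rfl⟩
  have p1 : Function.Periodic (fun z => f z) 1 := f.add_one τ
  have p2 : Function.Periodic (fun z => f z) τ := f.add_tau τ
  have hτ : (τ : ℂ).im ≠ 0 := τ.im_pos.ne'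
  set y := z.im / (τ : ℂ).im with hy
  set x := z.re - y * (τ : ℂ).re with hx
  have hz : z = x + y * τ := by
    apply Complex.ext
    · simp [hx]
    · simpa [hy] using (div_mul_cancel₀ z.im hτ).symm
  refine ⟨(Int.fract x, Int.fract y), ⟨⟨Int.fract_nonneg _, (Int.fract_lt_one _).le⟩,
    ⟨Int.fract_nonneg _, (Int.fract_lt_one _).le⟩⟩, ?_⟩
  have e := (p1.int_mul ⌊x⌋ (((Int.fract x : ℝ) : ℂ) + ((Int.fract y : ℝ) : ℂ) * (τ : ℂ))).symm.trans
    (p2.int_mul ⌊y⌋ _).symm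
  change f _ = f _
  refine e.trans (congrArg (fun z => f z) ?_)
  rw [hz]
  simp only [Int.fract]
  push_cast
  ring

/-- A holomorphic function on `E_τ` is constant. -/
theorem Fn.eq_const_of_delbar {f : Fn τ} (hf : delbar τ f = 0) : f = const τ (f 0) := by
  -- The Cauchy-Riemann equation in the directions `1` and `I`; Liouville's theorem then applies.
  have hd : Differentiable ℂ (fun z => f z) := fun z => by
    refine differentiableAt_complex_iff_differentiableAt_real.2 ⟨f.differentiable τ z, ?_⟩
    have h1 := congrArg (fun k : Fn τ => k z) (dirDeriv_eq τ I f)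
    have h2 := congrArg (fun k : Fn τ => k z) (dirDeriv_eq τ 1 f)
    rw [hf, smul_zero, add_zero] at h1 h2
    rw [one_smul] at h2
    exact h1.trans (congrArg (I * ·) h2.symm)
  ext z
  exact hd.apply_eq_apply_of_bounded f.isBounded_range z 0

theorem H0.eq_const (f : H0 τ) : f.1 = const τ (f.1 0) :=
  Fn.eq_const_of_delbar (congrArg Prod.snd f.2)

variable (τ) in
/-- The closed `1`-form `α dz + β dz̄`. -/
def constForm (α β : ℂ) : Z1 τ := ⟨(const τ α, const τ β), by simp [d1, del_const, delbar_const]⟩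

variable (τ) in
/-- The class of `α dz + β dz̄`. -/
def constClass (α β : ℂ) : H1 τ := Submodule.Quotient.mk (constForm τ α β)

theorem period_constClass {v : ℂ} (hv : v = 1 ∨ v = τ) (α β : ℂ) :
    period τ v hv (constClass τ α β) = α * v + β * conj v := by
  change ∫ _ in (0 : ℝ)..1, (v * α + conj v * β) = _
  simp [mul_comm]

variable (τ) in
/-- The class of the constant function `c` in `H⁰`. -/
def constH0 (c : ℂ) : H0 τ := ⟨const τ c, by simp [d0, del_const, delbar_const]⟩

variable (τ) in
/-- The class of the constant form `c dz ∧ dz̄`. -/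
def constH2 (c : ℂ) : H2 τ := Submodule.Quotient.mk (const τ c)

theorem intE_mk (h : Fn τ) : intE τ (Submodule.Quotient.mk h) = intForm τ h := rfl

/-! ### Periods determine de Rham classes -/

theorem H0.ext_eval {f g : H0 τ} (h : f.1 0 = g.1 0) : f = g := by
  apply Subtype.ext
  rw [f.eq_const, g.eq_const, h]

theorem H1.ext_period {x y : H1 τ} (h1 : period τ 1 (Or.inl rfl) x = period τ 1 (Or.inl rfl) y)
    (h2 : period τ τ (Or.inr rfl) x = period τ τ (Or.inr rfl) y) : x = y := by
  rw [← sub_eq_zero] at h1 h2 ⊢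
  rw [← map_sub] at h1 h2
  generalize x - y = w at *
  obtain ⟨a, rfl⟩ := Submodule.Quotient.mk_surjective _ w
  exact (Submodule.Quotient.mk_eq_zero _).2 (mem_range_d0 a.2 h1 h2)

theorem H2.ext_int {x y : H2 τ} (h : intE τ x = intE τ y) : x = y := by
  rw [← sub_eq_zero] at h ⊢
  rw [← map_sub] at h
  generalize x - y = w at *
  obtain ⟨a, rfl⟩ := Submodule.Quotient.mk_surjective _ w
  exact (Submodule.Quotient.mk_eq_zero _).2 (mem_range_d1 h)

theorem periods_injective : Function.Injective (periods τ) := fun _ _ h =>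
  Prod.ext (H0.ext_eval (congrFun h 0))
    (Prod.ext (H1.ext_period (congrFun h 1) (congrFun h 2)) (H2.ext_int (congrFun h 3)))

variable (τ) in
/-- The class with harmonic representatives and with the given periods. -/
def ofPeriods (p : Fin 4 → ℂ) : HdR τ :=
  (constH0 τ (p 0),
    -- The coefficients solve `α + β = p 1`, `α τ + β τ̄ = p 2`, a system of determinant `τ̄ - τ`.
    constClass τ ((p 1 * conj (τ : ℂ) - p 2) / (conj (τ : ℂ) - τ))
      ((p 2 - p 1 * τ) / (conj (τ : ℂ) - τ)),
    constH2 τ (p 3 / (conj (τ : ℂ) - τ)))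

theorem periods_ofPeriods (p : Fin 4 → ℂ) : periods τ (ofPeriods τ p) = p := by
  have hne := conj_sub_ne_zero τ
  funext i
  fin_cases i
  · rfl
  · refine (period_constClass (Or.inl rfl) _ _).trans ?_
    simp only [map_one, Fin.mk_one]
    field_simp
    ring
  · refine (period_constClass (Or.inr rfl) _ _).trans ?_
    simp only [Fin.reduceFinMk]
    field_simp
    ring
  · refine (intForm_const _).trans ?_
    simp only [Fin.reduceFinMk]
    field_simp

theorem ofPeriods_periods (x : HdR τ) : ofPeriods τ (periods τ x) = x :=
  periods_injective (periods_ofPeriods _)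

variable (τ) in
/-- The period isomorphism. -/
def periodsEquiv : HdR τ ≃ₗ[ℂ] (Fin 4 → ℂ) :=
  { periods τ with
    invFun := ofPeriods τ
    left_inv := ofPeriods_periods
    right_inv := periods_ofPeriods }

theorem H1.eq_constClass (y : H1 τ) :
    y = constClass τ
      ((period τ 1 (Or.inl rfl) y * conj (τ : ℂ) - period τ τ (Or.inr rfl) y)
        / (conj (τ : ℂ) - τ))
      ((period τ τ (Or.inr rfl) y - period τ 1 (Or.inl rfl) y * τ) / (conj (τ : ℂ) - τ)) :=
  (congrArg (fun x => x.2.1) (ofPeriods_periods (τ := τ) (0, y, 0))).symm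

/-! ### The pairings in terms of periods -/

theorem intE_cup02 (f : H0 τ) (x : H2 τ) : intE τ (cup02 τ f x) = f.1 0 * intE τ x := by
  obtain ⟨h, rfl⟩ := Submodule.Quotient.mk_surjective _ x
  change intForm τ (f.1 * h) = _ * intForm τ h
  conv_lhs => rw [f.eq_const]
  exact intForm_const_mul _ h

/-- Riemann's bilinear relation. On constant forms the period matrix is the coefficient matrix times
a matrix of determinant `τ̄ - τ`, which is also the integral of `dz ∧ dz̄`. -/
theorem intE_cup11 (x y : H1 τ) : intE τ (cup11 τ x y) =
    period τ 1 (Or.inl rfl) x * period τ τ (Or.inr rfl) y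
      - period τ τ (Or.inr rfl) x * period τ 1 (Or.inl rfl) y := by
  have h (α β α' β' : ℂ) : intE τ (cup11 τ (constClass τ α β) (constClass τ α' β'))
      = (α * β' - β * α') * (conj (τ : ℂ) - τ) := by
    rw [← intForm_const]
    change intForm τ (const τ α * const τ β' - const τ β * const τ α') = _
    congr 1
  rw [x.eq_constClass, y.eq_constClass, h]
  simp only [period_constClass, map_one]
  ring

theorem poincare_eq_periods (x y : HdR τ) : poincare τ x y =
    periods τ x 0 * periods τ y 3 + (periods τ x 1 * periods τ y 2 - periods τ x 2 * periods τ y 1)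
      + periods τ y 0 * periods τ x 3 := by
  rw [poincare, map_add, map_add, intE_cup02, intE_cup11, intE_cup02]
  rfl

theorem serre_eq (f : Dol0 τ) (w : Dol1 τ) : serre τ f w = f.1 0 * intE τ (hodgeTwo τ w) := by
  obtain ⟨h, rfl⟩ := Submodule.Quotient.mk_surjective _ w
  change intForm τ (f.1 * h) = _ * intForm τ h
  conv_lhs => rw [Fn.eq_const_of_delbar f.2]
  exact intForm_const_mul _ h

theorem hodgeIncl_eq (u : HHone τ) : hodgeIncl τ u = constClass τ (u.1 0) 0 := by
  have h : (u.1, (0 : Fn τ)) = (const τ (u.1 0), const τ 0) := by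
    rw [← Fn.eq_const_of_delbar u.2]
    simp [const]
  exact congrArg (Submodule.Quotient.mk (p := B1 τ)) (Subtype.ext h)

theorem period_hodgeIncl {v : ℂ} (hv : v = 1 ∨ v = τ) (u : HHone τ) :
    period τ v hv (hodgeIncl τ u) = u.1 0 * v := by
  rw [hodgeIncl_eq, period_constClass, zero_mul, add_zero]

theorem hodgeProj_eq (y : H1 τ) : hodgeProj τ y =
    ((period τ τ (Or.inr rfl) y - period τ 1 (Or.inl rfl) y * τ) / (conj (τ : ℂ) - τ)) •
      Submodule.Quotient.mk 1 := by
  conv_lhs => rw [y.eq_constClass]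
  rw [← Submodule.Quotient.mk_smul, ← const_eq_smul_one]
  rfl

/-- This is the integral of `dz ∧ y`, which kills multiples of `dz` and so sees only the projection
of `y`. -/
theorem intE_hodgeTwo_hodgeProj (y : H1 τ) : intE τ (hodgeTwo τ (hodgeProj τ y)) =
    period τ τ (Or.inr rfl) y - period τ 1 (Or.inl rfl) y * τ := by
  have hne := conj_sub_ne_zero τ
  rw [hodgeProj_eq, ← Submodule.Quotient.mk_smul, ← const_eq_smul_one]
  refine (intForm_const _).trans ?_
  field_simp

theorem periods_one_form (y : H1 τ) : periods τ (0, y, 0) =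
    ![0, period τ 1 (Or.inl rfl) y, period τ τ (Or.inr rfl) y, 0] := by
  funext i
  fin_cases i
  · rfl
  · rfl
  · rfl
  · exact map_zero (intE τ)

theorem periods_hodgeIncl (u : HHone τ) : periods τ (0, hodgeIncl τ u, 0) =
    ![0, u.1 0, u.1 0 * τ, 0] := by
  rw [periods_one_form, period_hodgeIncl, period_hodgeIncl, mul_one]

theorem periods_even (b : H0 τ) (c : H2 τ) : periods τ (b, 0, c) =
    ![b.1 0, 0, 0, intE τ c] := by
  funext i
  fin_cases i
  · rfl
  · exact map_zero (period τ 1 (Or.inl rfl))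
  · exact map_zero (period τ τ (Or.inr rfl))
  · rfl

variable (τ) in
/-- The Mukai pairing of `u` and `v` in terms of the periods of lifts. -/
theorem mukai_eq (u v : HH τ) : mukai τ u v = 1 / (2 * Real.pi * I) *
    (- (u.1.1 0 * intE τ (hodgeTwo τ v.2.2)) + u.2.1.1.1 0 * intE τ (hodgeTwo τ v.2.1.2)
      - v.2.1.1.1 0 * intE τ (hodgeTwo τ u.2.1.2) - v.1.1 0 * intE τ (hodgeTwo τ u.2.2)) := by
  simp only [mukai, serre_eq]

/-! ### Periods of classes on the two-torus -/

theorem periods_oneClass (σ : ℍ) : periods σ (oneClass σ, 0, 0) = ![1, 0, 0, 0] := by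
  rw [periods_even, map_zero]
  rfl

theorem intE_ptClass (σ : ℍ) : intE σ (ptClass σ) = 1 := by
  refine (intForm_const _).trans ?_
  have hne := conj_sub_ne_zero σ
  field_simp

theorem periods_ptClass (σ : ℍ) : periods σ (0, 0, ptClass σ) = ![0, 0, 0, 1] := by
  rw [periods_even, intE_ptClass]
  rfl

theorem periods_cupOmega {σ : ℍ} {ω : Fn σ} (hω : intForm σ ω = 1) (x : HdR σ) :
    periods σ (cupOmega σ ω x) = ![0, 0, 0, periods σ x 0] := by
  rw [cupOmega, periods_even, intE_cup02, intE_mk, hω, mul_one]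
  rfl

/-! ### The correspondence in terms of periods -/

theorem corrOne_iff {σ : ℍ} (φ : HdR σ ≃ₗ[ℂ] HdR τ) (x : H0 σ) (c : ℂ)
    (h : periods τ (φ (x, 0, 0)) = ![0, c, c * τ, 0]) (u : HHone τ) :
    CorrOne φ x u ↔ u = c • ⟨1, delbar_one τ⟩ := by
  rw [CorrOne, ← periods_injective.eq_iff, h, periods_hodgeIncl]
  constructor
  · intro e
    have e1 : c = u.1 0 := congrFun e 1
    apply Subtype.ext
    rw [Fn.eq_const_of_delbar u.2, ← e1, const_eq_smul_one]
    rfl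
  · rintro rfl
    change _ = ![0, c * 1, c * 1 * (τ : ℂ), 0]
    rw [mul_one]

theorem corrMinusOne_iff {σ : ℍ} (φ : HdR σ ≃ₗ[ℂ] HdR τ) (x : H2 σ) (p q : ℂ)
    (h : periods τ (φ (0, 0, x)) = ![0, p, q, 0]) (u : HHminusOne τ) :
    CorrMinusOne φ x u ↔
      u = ((q - p * τ) / (conj (τ : ℂ) - τ)) • Submodule.Quotient.mk 1 := by
  have key (y : H1 τ) (e : φ (0, 0, x) = (0, y, 0)) :
      hodgeProj τ y = ((q - p * τ) / (conj (τ : ℂ) - τ)) • Submodule.Quotient.mk 1 := by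
    rw [e, periods_one_form] at h
    have h1 : period τ 1 (Or.inl rfl) y = p := congrFun h 1
    have h2 : period τ τ (Or.inr rfl) y = q := congrFun h 2
    rw [hodgeProj_eq, h1, h2]
  constructor
  · rintro ⟨y, hy, rfl⟩
    exact key y hy
  · rintro rfl
    have e : φ (0, 0, x) = (0, (φ (0, 0, x)).2.1, 0) := by
      rw [← periods_injective.eq_iff, periods_one_form, h]
      funext i
      fin_cases i
      · rfl
      · exact (congrFun h 1).symm
      · exact (congrFun h 2).symm
      · rfl
    exact ⟨_, e, key _ e⟩

end

/-! ### The mirror isomorphism -/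

/-- The mirror isomorphism in terms of periods. -/
def periodMap (w : ℂ) : (Fin 4 → ℂ) ≃ₗ[ℂ] (Fin 4 → ℂ) where
  -- The class `1` must go to `2πi (1, w)`, the periods of `2πi dz`. Its derivative under `(1 / 2πi)
  -- ∂_w` is `(0, 1)`, which must be the image of `-[pt]`: hence `- p 3`. The factor `2πi` on `p 2`
  -- cancels the `1 / 2πi` in the Mukai pairing.
  toFun p := ![p 1, 2 * Real.pi * I * p 0, 2 * Real.pi * I * p 0 * w - p 3, 2 * Real.pi * I * p 2]
  invFun q := ![q 1 / (2 * Real.pi * I), q 0, q 3 / (2 * Real.pi * I), q 1 * w - q 2]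
  map_add' p q := by
    funext i
    fin_cases i <;> simp <;> ring
  map_smul' c p := by
    funext i
    fin_cases i <;> simp <;> ring
  left_inv p := by
    funext i
    fin_cases i <;> simp
  right_inv q := by
    funext i
    fin_cases i <;> simp <;> field_simp
    simp

/-- The mirror isomorphism `H^•(Ě) → H^•_dR(E_τ)`. -/
def mirrorIso (σ τ : ℍ) : HdR σ ≃ₗ[ℂ] HdR τ :=
  periodsEquiv σ ≪≫ₗ periodMap τ ≪≫ₗ (periodsEquiv τ).symm

variable {σ τ : ℍ}

theorem mirrorIso_apply (x : HdR σ) :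
    mirrorIso σ τ x = ofPeriods τ (periodMap τ (periods σ x)) := rfl

theorem periods_mirrorIso (x : HdR σ) : periods τ (mirrorIso σ τ x) =
    ![periods σ x 1, 2 * Real.pi * I * periods σ x 0,
      2 * Real.pi * I * periods σ x 0 * τ - periods σ x 3, 2 * Real.pi * I * periods σ x 2] :=
  periods_ofPeriods _

/-- The loop `B` of `τ + 1` is `B + A` of `τ`, so the `B`-period shifts by the `A`-period; with this
shift the constant representatives coincide. -/
theorem sameClass_ofPeriods {τ' : ℍ} {p q : Fin 4 → ℂ} (hτ : (τ' : ℂ) = τ + 1) (h0 : p 0 = q 0)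
    (h1 : p 1 = q 1) (h2 : p 2 + p 1 = q 2) (h3 : p 3 = q 3) :
    SameClass (ofPeriods τ p) (ofPeriods τ' q) := by
  have hc : conj (τ' : ℂ) = conj (τ : ℂ) + 1 := by rw [hτ, map_add, map_one]
  refine ⟨constForm τ _ _, const τ _, constForm τ' _ _, const τ' _, rfl, rfl, fun z =>
    ⟨h0, ?_, ?_, ?_⟩⟩
  · change (_ : ℂ) / _ = _ / _
    rw [hc, hτ, ← h1, ← h2]
    congr 1 <;> ring
  · change (_ : ℂ) / _ = _ / _
    rw [hc, hτ, ← h1, ← h2]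
    congr 1 <;> ring
  · change (_ : ℂ) / _ = _ / _
    rw [hc, hτ, ← h3]
    congr 1
    ring

theorem corr_mirrorIso {x : HdR σ} {u : HH τ} (h : Corr (mirrorIso σ τ) x u) :
    u.1.1 0 = 2 * Real.pi * I * periods σ x 0 ∧ u.2.1.1.1 0 = periods σ x 1 ∧
      intE τ (hodgeTwo τ u.2.1.2) = 2 * Real.pi * I * periods σ x 2 ∧
      intE τ (hodgeTwo τ u.2.2) = - periods σ x 3 := by
  obtain ⟨h1, ⟨b, hb, h0⟩, ⟨y, hy, hy'⟩⟩ := h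
  have e1 := congrArg (periods τ) h1
  have e0 := congrArg (periods τ) h0
  have e2 := congrArg (periods τ) hy
  rw [periods_mirrorIso] at e1 e0 e2
  rw [periods_hodgeIncl] at e1
  rw [periods_even] at e0
  rw [periods_one_form] at e2
  refine ⟨(congrFun e1 1).symm, ?_, (congrFun e0 3).symm, ?_⟩
  · rw [← hb]
    exact (congrFun e0 0).symm
  · rw [← hy', intE_hodgeTwo_hodgeProj]
    have a1 : 2 * Real.pi * I * periods σ (0, 0, x.2.2) 0 = period τ 1 (Or.inl rfl) y :=
      congrFun e2 1
    have a2 : 2 * Real.pi * I * periods σ (0, 0, x.2.2) 0 * τ - periods σ x 3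
        = period τ τ (Or.inr rfl) y := congrFun e2 2
    rw [← a1, ← a2]
    ring

theorem mukai_of_corr_mirrorIso {x y : HdR σ} {u v : HH τ} (hx : Corr (mirrorIso σ τ) x u)
    (hy : Corr (mirrorIso σ τ) y v) : mukai τ u v = poincare σ x y := by
  obtain ⟨a1, a2, a3, a4⟩ := corr_mirrorIso hx
  obtain ⟨b1, b2, b3, b4⟩ := corr_mirrorIso hy
  have hpi := two_pi_I_ne_zero
  rw [mukai_eq, poincare_eq_periods, a1, a2, a3, a4, b1, b2, b3, b4]
  generalize (2 * Real.pi * I : ℂ) = k at *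
  field_simp
  ring

/-! ### Compatibility with the connections, parity, filtration and monodromy -/

theorem eventually_im_pos (τ : ℍ) : ∀ᶠ w : ℂ in nhds (τ : ℂ), 0 < w.im :=
  continuous_im.continuousAt.eventually (lt_mem_nhds τ.im_pos)

/-- By the chain rule `∂_w = 2πi q∂_q` on `s`. The explicit factor `w` in the `B`-entry of
`periodMap` contributes one more term, which is exactly the image of `- s ∪ [ω]` up to the common
factor `2πi`. -/
theorem hasGaussManin_mirrorIso {s : ℂ → HdR σ} {s' : HdR σ} {ω : Fn σ} (hω : intForm σ ω = 1)
    (hs : HasSectionDeriv s s' (qCoord τ)) :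
    HasGaussManin (fun τ' => mirrorIso σ τ' (s (qCoord τ'))) τ
      ((2 * Real.pi * I : ℂ) •
        mirrorIso σ τ (qCoord τ • s' - cupOmega σ ω (s (qCoord τ)))) := by
  set q := qCoord τ with hq
  set P : Fin 4 → ℂ → ℂ := fun j w => periods σ (s (exp (2 * Real.pi * I * w))) j with hP
  have hdP (j : Fin 4) :
      HasDerivAt (P j) (periods σ s' j * (q * (2 * Real.pi * I))) (τ : ℂ) := by
    have h1 : HasDerivAt (fun w : ℂ => exp (2 * Real.pi * I * w)) (q * (2 * Real.pi * I)) τ := by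
      refine ((hasDerivAt_id (τ : ℂ)).const_mul (2 * Real.pi * I : ℂ)).cexp.congr_deriv ?_
      rw [mul_one]
      rfl
    exact HasDerivAt.comp (τ : ℂ) (hs (LinearMap.proj j ∘ₗ periods σ)) h1
  have hPτ (j : Fin 4) : P j τ = periods σ (s q) j := rfl
  have hd2 := ((hdP 0).const_mul (2 * Real.pi * I : ℂ)).mul (hasDerivAt_id (τ : ℂ)) |>.sub (hdP 3)
  -- `ofComplex` is meaningful only on the upper half-plane, so the formula holds only near `τ`.
  have hev : ∀ᶠ w : ℂ in nhds (τ : ℂ), periods (UpperHalfPlane.ofComplex w)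
      (mirrorIso σ (UpperHalfPlane.ofComplex w) (s (qCoord (UpperHalfPlane.ofComplex w))))
      = periodMap w (fun j => P j w) := by
    filter_upwards [eventually_im_pos τ] with w hw
    rw [periods_mirrorIso, UpperHalfPlane.ofComplex_apply_of_im_pos hw]
    rfl
  intro i
  rw [map_smul, periods_mirrorIso]
  refine HasDerivAt.congr_of_eventuallyEq ?_ (hev.mono fun w hw => congrFun hw i)
  simp only [map_sub, map_smul, periods_cupOmega hω]
  fin_cases i
  · refine (hdP 1).congr_deriv ?_
    simp
    ring
  · refine ((hdP 0).const_mul (2 * Real.pi * I : ℂ)).congr_deriv ?_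
    simp
    ring
  · refine hd2.congr_deriv ?_
    simp [hPτ]
    ring
  · refine ((hdP 2).const_mul (2 * Real.pi * I : ℂ)).congr_deriv ?_
    simp
    ring

theorem mirrorIso_even (a : H0 σ) (c : H2 σ) :
    (mirrorIso σ τ (a, 0, c)).1 = 0 ∧ (mirrorIso σ τ (a, 0, c)).2.2 = 0 := by
  have h := periods_mirrorIso (τ := τ) (a, (0 : H1 σ), c)
  rw [periods_even] at h
  refine ⟨H0.ext_eval (congrFun h 0), H2.ext_int ?_⟩
  refine (congrFun h 3).trans ?_
  simp

theorem mirrorIso_odd (b : H1 σ) : (mirrorIso σ τ (0, b, 0)).2.1 = 0 := by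
  have h := periods_mirrorIso (τ := τ) ((0 : H0 σ), b, (0 : H2 σ))
  rw [periods_one_form] at h
  refine H1.ext_period ((congrFun h 1).trans ?_) ((congrFun h 2).trans ?_) <;> simp

/-- The entry `p 3` measures how far the `B`-period is from `τ` times the `A`-period, so lying on
the Hodge line forces `p 3 = 0`. -/
theorem mirrorIso_filtration (x : HdR σ) :
    (∃ a, x = (a, 0, 0)) ↔ ∃ u, mirrorIso σ τ x = (0, hodgeIncl τ u, 0) := by
  have hpi := two_pi_I_ne_zero
  constructor
  · rintro ⟨a, rfl⟩
    refine ⟨(2 * Real.pi * I * a.1 0 : ℂ) • ⟨1, delbar_one τ⟩, periods_injective ?_⟩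
    rw [periods_mirrorIso, periods_hodgeIncl, periods_even, map_zero]
    have : ((2 * Real.pi * I * a.1 0 : ℂ) • (⟨1, delbar_one τ⟩ : HHone τ)).1 0
      = 2 * Real.pi * I * a.1 0 := mul_one _
    rw [this]
    simp
  · rintro ⟨u, hu⟩
    have h := congrArg (periods τ) hu
    rw [periods_mirrorIso, periods_hodgeIncl] at h
    have h0 : periods σ x 1 = 0 := congrFun h 0
    have h1 : 2 * Real.pi * I * periods σ x 0 = u.1 0 := congrFun h 1
    have h2 : 2 * Real.pi * I * periods σ x 0 * τ - periods σ x 3 = u.1 0 * τ := congrFun h 2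
    have h3 : 2 * Real.pi * I * periods σ x 2 = 0 := congrFun h 3
    have h3' := (mul_eq_zero.1 h3).resolve_left hpi
    have h2' : periods σ x 3 = 0 := by
      rw [h1] at h2
      linear_combination -h2
    refine ⟨x.1, Prod.ext rfl (Prod.ext (H1.ext_period ?_ ?_) (H2.ext_int ?_))⟩
    · exact h0.trans (map_zero _).symm
    · exact h3'.trans (map_zero _).symm
    · exact h2'.trans (map_zero _).symm

theorem mirrorIso_monodromy {τ' : ℍ} (hτ : (τ' : ℂ) = τ + 1) (x : HdR σ) :
    SameClass (mirrorIso σ τ x) (mirrorIso σ τ' x) := by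
  rw [mirrorIso_apply, mirrorIso_apply]
  refine sameClass_ofPeriods hτ rfl rfl ?_ rfl
  simp [periodMap, hτ]
  ring

theorem isMirrorIso_mirrorIso {ω : Fn σ} (hω : intForm σ ω = 1) (R : ℝ) :
    IsMirrorIso ω R (mirrorIso σ) where
  even_to_odd _ _ := mirrorIso_even
  odd_to_even _ _ := mirrorIso_odd
  filtration _ _ := mirrorIso_filtration
  monodromy _ _ _ hτ := mirrorIso_monodromy hτ
  connection τ _ s t := by
    rintro ⟨s', hs, rfl⟩
    refine ⟨_, hasGaussManin_mirrorIso hω hs, ?_⟩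
    rw [smul_smul, one_div, inv_mul_cancel₀ two_pi_I_ne_zero, one_smul]
  pairing _ _ _ _ _ _ := mukai_of_corr_mirrorIso

/-! ### Uniqueness of the mirror isomorphism on the even part -/

/-- If the family with periods `(p, p w)` along the two loops has a flat derivative, with periods
`(k q₁, k q₂)`, then `p` is constant. -/
theorem const_of_hasDerivAt {U : Set ℂ} (hU : IsOpen U) (hc : IsPreconnected U) {k : ℂ} (hk : k ≠ 0)
    {p r q₁ q₂ : ℂ → ℂ} (hp : ∀ w ∈ U, HasDerivAt p (k * q₁ w) w)
    (hr : ∀ w ∈ U, HasDerivAt r (k * q₂ w) w) (h1 : ∀ w ∈ U, HasDerivAt q₁ 0 w)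
    (h2 : ∀ w ∈ U, HasDerivAt q₂ 0 w) (hpr : ∀ w ∈ U, r w = p w * w) :
    (∀ w ∈ U, q₁ w = 0) ∧ (∀ w ∈ U, k * q₂ w = p w) ∧ ∀ w ∈ U, ∀ w' ∈ U, p w = p w' := by
  -- The product rule for `r = p w`.
  have e1 : ∀ w ∈ U, k * q₂ w = k * q₁ w * w + p w := fun w hw => by
    have h := (hp w hw).mul (hasDerivAt_id w)
    rw [mul_one] at h
    refine (hr w hw).unique (h.congr_of_eventuallyEq ?_)
    filter_upwards [hU.mem_nhds hw] with z hz using hpr z hz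
  -- Differentiating `e1` with `q₁`, `q₂` locally constant gives `0 = 2 k q₁`.
  have e2 : ∀ w ∈ U, q₁ w = 0 := fun w hw => by
    have h := (((h1 w hw).const_mul k).mul (hasDerivAt_id w)).add (hp w hw)
    have h' := ((h2 w hw).const_mul k).unique (h.congr_of_eventuallyEq (by
      filter_upwards [hU.mem_nhds hw] with z hz using e1 z hz))
    have h'' : k * q₁ w = 0 := by
      simp only [mul_zero, zero_mul, mul_one, zero_add] at h'
      linear_combination -h' / 2
    exact (mul_eq_zero.1 h'').resolve_left hk
  refine ⟨e2, fun w hw => by rw [e1 w hw, e2 w hw]; ring, fun w hw w' hw' => ?_⟩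
  refine hU.is_const_of_deriv_eq_zero hc
    (fun z hz => (hp z hz).differentiableAt.differentiableWithinAt) (fun z hz => ?_) hw hw'
  rw [(hp z hz).deriv, e2 z hz, mul_zero]
  rfl

theorem cupOmega_oneClass {ω : Fn σ} (hω : intForm σ ω = 1) :
    cupOmega σ ω (oneClass σ, 0, 0) = (0, 0, ptClass σ) := by
  apply periods_injective
  rw [periods_cupOmega hω, periods_ptClass, periods_oneClass]
  rfl

theorem cupOmega_ptClass {ω : Fn σ} (hω : intForm σ ω = 1) :
    cupOmega σ ω (0, 0, ptClass σ) = 0 := by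
  apply periods_injective
  rw [periods_cupOmega hω, periods_ptClass, map_zero]
  funext i
  fin_cases i <;> rfl

/-- For a constant section only the term `- x ∪ [ω]` of the Dubrovin connection survives. -/
theorem IsMirrorIso.hasDerivAt_periods {ω : Fn σ} {R : ℝ} {Φ : ∀ τ : ℍ, HdR σ ≃ₗ[ℂ] HdR τ}
    (hΦ : IsMirrorIso ω R Φ) (hτ : R < τ.im) (x : HdR σ) (i : Fin 4) :
    HasDerivAt (fun w : ℂ => periods (UpperHalfPlane.ofComplex w)
      (Φ (UpperHalfPlane.ofComplex w) x) i)
      (-(2 * Real.pi * I) * periods τ (Φ τ (cupOmega σ ω x)) i) τ := by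
  have hD : HasDubrovin ω (fun _ => x) (-cupOmega σ ω x) (qCoord τ) :=
    ⟨0, fun l => by simpa using hasDerivAt_const _ _, by simp⟩
  obtain ⟨β, hβ, e⟩ := hΦ.connection τ hτ _ _ hD
  refine (hβ i).congr_deriv ?_
  have e' : β = (2 * Real.pi * I : ℂ) • Φ τ (-cupOmega σ ω x) := by
    rw [e, smul_smul, one_div, mul_inv_cancel₀ two_pi_I_ne_zero, one_smul]
  rw [e', map_smul, map_neg, map_neg]
  simp

theorem IsMirrorIso.periods_oneClass_and_ptClass {ω : Fn σ} (hω : intForm σ ω = 1) {R : ℝ}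
    {Φ : ∀ τ : ℍ, HdR σ ≃ₗ[ℂ] HdR τ} (hΦ : IsMirrorIso ω R Φ) :
    ∃ ε : ℂ, (ε = 1 ∨ ε = -1) ∧ ∀ τ : ℍ, R < τ.im →
      periods τ (Φ τ (oneClass σ, 0, 0))
        = ![0, ε * (2 * Real.pi * I), ε * (2 * Real.pi * I) * τ, 0] ∧
      periods τ (Φ τ (0, 0, ptClass σ)) = ![0, 0, -ε, 0] := by
  have hpi := two_pi_I_ne_zero
  -- `max R 0` encodes both the bound by `R` and membership in the upper half-plane, giving a
  -- convex, hence connected, open set.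
  set U : Set ℂ := {w | max R 0 < w.im} with hU
  have hmem (τ : ℍ) (hτ : R < τ.im) : (τ : ℂ) ∈ U := max_lt hτ τ.im_pos
  have hlift (w : ℂ) (hw : w ∈ U) : ∃ τ : ℍ, R < τ.im ∧ w = τ :=
    ⟨⟨w, (le_max_right _ _).trans_lt hw⟩, (le_max_left _ _).trans_lt hw, rfl⟩
  have hUo : IsOpen U := isOpen_lt continuous_const continuous_im
  have hUc : IsPreconnected U := (convex_halfSpace_im_gt _).isPreconnected
  set f : HdR σ → Fin 4 → ℂ → ℂ := fun x i w => periods (UpperHalfPlane.ofComplex w)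
    (Φ (UpperHalfPlane.ofComplex w) x) i with hf
  have hfτ (x : HdR σ) (i : Fin 4) (τ : ℍ) : f x i τ = periods τ (Φ τ x) i :=
    congrArg (fun τ' => periods τ' (Φ τ' x) i) (UpperHalfPlane.ofComplex_apply τ)
  have hfd (x : HdR σ) (i : Fin 4) : ∀ w ∈ U,
      HasDerivAt (f x i) (-(2 * Real.pi * I) * f (cupOmega σ ω x) i w) w := fun w hw => by
    obtain ⟨τ, hτ, rfl⟩ := hlift w hw
    rw [hfτ]
    exact hΦ.hasDerivAt_periods hτ x i
  have hone (τ : ℍ) (hτ : R < τ.im) : ∃ u, Φ τ (oneClass σ, 0, 0) = (0, hodgeIncl τ u, 0) :=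
    (hΦ.filtration τ hτ _).1 ⟨_, rfl⟩
  set x := ((oneClass σ, 0, 0) : HdR σ) with hx
  set y := ((0, 0, ptClass σ) : HdR σ) with hy
  have hxy : cupOmega σ ω x = y := cupOmega_oneClass hω
  have hy0 : ∀ i, ∀ w ∈ U, HasDerivAt (f y i) 0 w := fun i w hw => by
    have h := hfd y i w hw
    rw [cupOmega_ptClass hω] at h
    simpa [hf] using h
  have hp := hfd x
  rw [hxy] at hp
  obtain ⟨q1, q2, pc⟩ := const_of_hasDerivAt hUo hUc (neg_ne_zero.2 hpi) (hp 1) (hp 2) (hy0 1)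
    (hy0 2) (fun w hw => by
      obtain ⟨τ, hτ, rfl⟩ := hlift w hw
      obtain ⟨u, hu⟩ := hone τ hτ
      rw [hfτ, hfτ, hu, periods_hodgeIncl]
      rfl)
  have hPt (τ : ℍ) (hτ : R < τ.im) : periods τ (Φ τ y) = ![0, 0, f y 2 τ, 0] := by
    obtain ⟨a0, a3⟩ := hΦ.even_to_odd τ hτ 0 (ptClass σ)
    funext i
    fin_cases i
    · rw [← hy] at a0
      change (Φ τ y).1.1 0 = 0
      rw [a0]
      rfl
    · exact (hfτ y 1 τ).symm.trans (q1 _ (hmem τ hτ))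
    · exact (hfτ y 2 τ).symm
    · rw [← hy] at a3
      change intE τ (Φ τ y).2.2 = 0
      rw [a3, map_zero]
  have hOne (τ : ℍ) (hτ : R < τ.im) : periods τ (Φ τ x) = ![0, f x 1 τ, f x 1 τ * τ, 0] := by
    obtain ⟨u, hu⟩ := hone τ hτ
    rw [hfτ, hu, periods_hodgeIncl]
    rfl
  have hsq (τ : ℍ) (hτ : R < τ.im) : f x 1 τ ^ 2 = (2 * Real.pi * I) ^ 2 := by
    have c1 := (corrOne_iff (Φ τ) (oneClass σ) _ (hOne τ hτ) _).2 rfl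
    obtain ⟨z, hz, -⟩ := (corrMinusOne_iff (Φ τ) (ptClass σ) _ _ (hPt τ hτ) _).2 rfl
    have hpair := hΦ.pairing τ hτ x y (f x 1 τ • ⟨1, delbar_one τ⟩, 0, 0)
      (0, 0, hodgeProj τ z)
      ⟨c1, ⟨0, map_zero _, by
        simp only [hx, Prod.snd_zero, map_zero]
        exact map_zero _⟩, ⟨0, map_zero _, map_zero _⟩⟩
      ⟨by
        simp only [CorrOne, hy, map_zero]
        exact map_zero _, ⟨0, map_zero _, by
        simp only [hy, Prod.snd_zero, map_zero]
        exact map_zero _⟩, ⟨z, hz, rfl⟩⟩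
    rw [mukai_eq, poincare_eq_periods, hx, hy, periods_oneClass, periods_ptClass] at hpair
    have hzp := hPt τ hτ
    rw [hy, hz, periods_one_form] at hzp
    have z1 : period τ 1 (Or.inl rfl) z = 0 := congrFun hzp 1
    have z2 : period τ τ (Or.inr rfl) z = f y 2 τ := congrFun hzp 2
    rw [intE_hodgeTwo_hodgeProj, z1, z2] at hpair
    have hu : (f x 1 τ • (⟨1, delbar_one τ⟩ : HHone τ)).1 0 = f x 1 τ := mul_one _
    rw [hu] at hpair
    have hpair' : 1 / (2 * Real.pi * I : ℂ) * -(f x 1 τ * f y 2 τ) = 1 := by simpa using hpair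
    rw [one_div, inv_mul_eq_iff_eq_mul₀ hpi, mul_one] at hpair'
    -- The pairing gives `-p q₂ = 2πi` and the connection gives `-2πi q₂ = p`; eliminating `q₂`
    -- leaves `p² = (2πi)²`.
    linear_combination (2 * Real.pi * I : ℂ) * hpair' - f x 1 τ * q2 _ (hmem τ hτ)
  set τ₀ : ℍ := ⟨⟨0, max R 0 + 1⟩, by positivity⟩ with hτ₀
  have hR₀ : R < τ₀.im := (le_max_left R 0).trans_lt (lt_add_one _)
  refine ⟨f x 1 τ₀ / (2 * Real.pi * I), ?_, fun τ hτ => ?_⟩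
  · rcases sq_eq_sq_iff_eq_or_eq_neg.1 (hsq τ₀ hR₀) with h | h
    · left
      rw [h, div_self hpi]
    · right
      rw [h, neg_div, div_self hpi]
  · have e := pc _ (hmem τ₀ hR₀) _ (hmem τ hτ)
    have e2 := q2 _ (hmem τ hτ)
    rw [div_mul_cancel₀ _ hpi, e, hOne τ hτ, hPt τ hτ, ← e2]
    refine ⟨rfl, ?_⟩
    congr 3
    field_simp

end

end EllipticMirror

/-- For every area one symplectic form on the two-torus and every neighbourhood `Im τ > R` of the
cusp there is a mirror isomorphism from the A-model to the B-model variation of Hodge structures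
under which `1` corresponds to `[2πi dz]` and `[pt]^PD` corresponds to `[dz̄] / (τ - τ̄)`, and
under every mirror isomorphism the corresponding classes are these, up to one common sign. -/
theorem mainTheorem9 (σ : UpperHalfPlane) (ω : EllipticMirror.Fn σ)
    (hω : EllipticMirror.IsSymplecticOfAreaOne σ ω) (R : ℝ) :
    (∃ Φ : ∀ τ : UpperHalfPlane, EllipticMirror.HdR σ ≃ₗ[ℂ] EllipticMirror.HdR τ,
      EllipticMirror.IsMirrorIso ω R Φ ∧
      ∀ τ : UpperHalfPlane, R < τ.im →
        (∀ u, EllipticMirror.CorrOne (Φ τ) (EllipticMirror.oneClass σ) u ↔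
          u = EllipticMirror.OmegaClass τ) ∧
        (∀ u, EllipticMirror.CorrMinusOne (Φ τ) (EllipticMirror.ptClass σ) u ↔
          u = EllipticMirror.xiClass τ)) ∧
    ∀ Φ : ∀ τ : UpperHalfPlane, EllipticMirror.HdR σ ≃ₗ[ℂ] EllipticMirror.HdR τ,
      EllipticMirror.IsMirrorIso ω R Φ →
      ∃ ε : ℂ, (ε = 1 ∨ ε = -1) ∧
        ∀ τ : UpperHalfPlane, R < τ.im →
          (∀ u, EllipticMirror.CorrOne (Φ τ) (EllipticMirror.oneClass σ) u ↔
            u = ε • EllipticMirror.OmegaClass τ) ∧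
          (∀ u, EllipticMirror.CorrMinusOne (Φ τ) (EllipticMirror.ptClass σ) u ↔
            u = ε • EllipticMirror.xiClass τ) := by
  have key (ε : ℂ) (τ : UpperHalfPlane) (φ : EllipticMirror.HdR σ ≃ₗ[ℂ] EllipticMirror.HdR τ)
      (h : EllipticMirror.periods τ (φ (EllipticMirror.oneClass σ, 0, 0))
          = ![0, ε * (2 * Real.pi * Complex.I), ε * (2 * Real.pi * Complex.I) * τ, 0] ∧
        EllipticMirror.periods τ (φ (0, 0, EllipticMirror.ptClass σ)) = ![0, 0, -ε, 0]) :
      (∀ u, EllipticMirror.CorrOne φ (EllipticMirror.oneClass σ) u ↔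
        u = ε • EllipticMirror.OmegaClass τ) ∧
      (∀ u, EllipticMirror.CorrMinusOne φ (EllipticMirror.ptClass σ) u ↔
        u = ε • EllipticMirror.xiClass τ) := by
    refine ⟨fun u => ?_, fun u => ?_⟩
    · rw [EllipticMirror.corrOne_iff _ _ _ h.1, EllipticMirror.OmegaClass, smul_smul]
    · rw [EllipticMirror.corrMinusOne_iff _ _ _ _ h.2, EllipticMirror.xiClass, smul_smul]
      -- A class with `A`- and `B`-periods `(0, -ε)` has `dz̄`-coefficient `-ε / (τ̄ - τ)`;
      -- reversing the denominator absorbs the sign.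
      have e : (-ε - 0 * (τ : ℂ)) / ((starRingEnd ℂ) (τ : ℂ) - τ)
          = ε * (1 / ((τ : ℂ) - (starRingEnd ℂ) (τ : ℂ))) := by
        rw [zero_mul, sub_zero, ← neg_sub (τ : ℂ), neg_div_neg_eq, mul_one_div]
      rw [e]
  refine ⟨⟨EllipticMirror.mirrorIso σ, EllipticMirror.isMirrorIso_mirrorIso hω.2 R,
    fun τ _ => ?_⟩, fun Φ hΦ => ?_⟩
  · have h := key 1 τ (EllipticMirror.mirrorIso σ τ) ⟨by
      rw [EllipticMirror.periods_mirrorIso, EllipticMirror.periods_oneClass]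
      simp, by
      rw [EllipticMirror.periods_mirrorIso, EllipticMirror.periods_ptClass]
      simp⟩
    simpa only [one_smul] using h
  · obtain ⟨ε, hε, h⟩ := hΦ.periods_oneClass_and_ptClass hω.2
    exact ⟨ε, hε, fun τ hτ => key ε τ (Φ τ) (h τ hτ)⟩
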